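/- **Setting.** Fix an integer $n\ge 0$ (the order of the increments), a step $\tau>0$ and a real function $a\in L_1(0,\infty)$. A *spectral density* is a nonnegative integrable Borel function on $\mathbb R$. Let $\mathcal D_f,\mathcal D_g$ be sets of spectral densities and $\mathcal D=\mathcal D_f\times\mathcal D_g$. For $(f,g)$ put $$p(\lambda)=f(\lambda)+\frac{\lambda^{2n}}{(1+\lambda^2)^n}g(\lambda),\qquad A(\lambda)=\int_0^\infty a(t)e^{-i\lambda t}dt,\qquad \theta(\lambda)=\frac{(i\lambda)^n}{(1+i\lambda)^n}.$$ Here $f$ is the spectral density of the $n$th increments of a process $\xi$, $g$ that of an uncorrelated stationary noise $\eta$, and $\xi+\eta$ is observed at times $t\le 0$ in order to estimate $A\xi=\int_0^\infty a(t)\xi(-t)dt$. Let $L_2^0(p)$ be the closed subspace of $L_2(p\,d\lambda)$ generated by the functions $e^{i\lambda t}(1-e^{-i\lambda\tau})^n(1+i\lambda)^n/(i\lambda)^n$, $t\le0$. The mean-square error of the linear estimate with spectral characteristic $h\in L_2^0(p)$ is $$\Delta(h;f,g)=\frac1{2\pi}\int_{-\infty}^\infty\Bigl(|A-h\theta|^2g+|h|^2f\Bigr)d\lambda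 ,\qquad \Delta(f,g)=\inf_{h\in L_2^0(p)}\Delta(h;f,g).$$ The pair $(f,g)$ satisfies the *minimality conditions* if $$\int\frac{|\gamma|^2}{p}\,d\lambda<\infty,\qquad \int\frac{|\gamma|^2\lambda^{2n}}{|1-e^{i\lambda\tau}|^{2n}(1+\lambda^2)^n\,p}\,d\lambda<\infty$$ for some nonzero function of exponential type $\gamma(\lambda)=\int_0^\infty\alpha(t)e^{i\lambda t}dt$, $\alpha\in L_1(0,\infty)$. **Operators.** Let $$\varphi_P=\frac{\lambda^{2n}|1-e^{i\lambda\tau}|^{-2n}}{(1+\lambda^2)^nf+\lambda^{2n}g},\qquad \varphi_S=\varphi_P\,g,\qquad \varphi_Q=\frac{(1+\lambda^2)^nfg}{(1+\lambda^2)^nf+\lambda^{2n}g},$$ $$(Py)(s)=\int_0^\infty y(t)\int e^{i\lambda(t-s)}\varphi_P\,d\lambda\,dt,\quad (Sx)(s)=\int_{-\tau n}^\infty x(t)\int e^{-i\lambda(t+s)}\varphi_S\,d\lambda\,dt,\quad (Qz)(s)=\int_0^\infty z(t)\int e^{i\lambda(t-s)}\varphi_Q\,d\lambda\,dt,$$ for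 $s\ge0$, and $a_\tau(t)=\sum_{l=\max\{0,\lceil -t/\tau\rceil\}}^{n}(-1)^l\binom nl a(t+\tau l)$ for $t\ge-\tau n$. Since $\varphi_P$ is not integrable, $P$ and $S$ are understood through their forms: for $y,z$ on $[0,\infty)$ with transforms $Y(\lambda)=\int_0^\infty y(t)e^{i\lambda t}dt$ and $Z(\lambda)=\int_0^\infty z(t)e^{i\lambda t}dt$, $$\langle Py,z\rangle=\int Y\,\varphi_P\,\overline{Z}\,d\lambda,\qquad \langle Sa_\tau,z\rangle=\int\Bigl(\int_{-\tau n}^\infty a_\tau(t)e^{-i\lambda t}dt\Bigr)\varphi_S(\lambda)\overline{Z(\lambda)}\,d\lambda .$$ The energy space of $P$ consists of the functions $y(t)=\frac1{2\pi}\int Y(\lambda)e^{-i\lambda t}d\lambda$ with $Y\in L_1(\mathbb R)$, $y(t)=0$ for $t\le0$, and $\int|Y|^2\varphi_P\,d\lambda<\infty$ (with $\varphi_P=\infty$ where $f$ and $g$ both vanish), and $c=P^{-1}Sa_\tau$ is the element of this space with $\langle Pc,z\rangle=\langle Sa_\tau,z\rangle$ for all $z$ in it. Let $C^\tau$ be the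 transform of $c$, and $$h_\tau(f,g)=\frac{A(\lambda)(1+i\lambda)^n(-i\lambda)^ng(\lambda)}{(1+\lambda^2)^nf(\lambda)+\lambda^{2n}g(\lambda)}-\frac{(1+i\lambda)^n(-i\lambda)^nC^\tau(\lambda)}{(1-e^{i\lambda\tau})^n\bigl((1+\lambda^2)^nf(\lambda)+\lambda^{2n}g(\lambda)\bigr)} .$$ **Statement.** Let $f^0\in\mathcal D_f$ and $g^0\in\mathcal D_g$ satisfy the minimality conditions, and suppose that $(f^0,g^0)$ maximizes the error functional $$\langle Sa_\tau,P^{-1}Sa_\tau\rangle+\langle Qa,a\rangle$$ over all $(f,g)\in\mathcal D_f\times\mathcal D_g$. Then: 1. $(f^0,g^0)$ is least favorable in $\mathcal D$, that is, $\Delta(f,g)\le\Delta(f^0,g^0)$ for all $(f,g)\in\mathcal D$; moreover $h_\tau(f^0,g^0)\in L_2^0(p^0)$, with $p^0$ the function $p$ of $(f^0,g^0)$, and $\Delta(h_\tau(f^0,g^0);f^0,g^0)=\Delta(f^0,g^0)$. 2. If $\mathcal D_f$ and $\mathcal D_g$ are convex and $h^0=h_\tau(f^0,g^0)$ belongs to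 $H_{\mathcal D}=\bigcap_{(f,g)\in\mathcal D}L_2^0(p)$, then $h^0$ is a minimax-robust spectral characteristic: $\max_{(f,g)\in\mathcal D}\Delta(h^0;f,g)$ is attained, and $$\max_{(f,g)\in\mathcal D}\Delta(h^0;f,g)=\min_{h\in H_{\mathcal D}}\ \sup_{(f,g)\in\mathcal D}\Delta(h;f,g).$$ -/

import Mathlib

open MeasureTheory Set
open scoped ENNReal ComplexConjugate

noncomputable section

namespace MinimaxFiltering

/-- A spectral density: a nonnegative (Borel) integrable function on the line. -/
structure IsSpectralDensity (f : ℝ → ℝ) : Prop where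
  measurable : Measurable f
  nonneg : ∀ x, 0 ≤ f x
  integrable : Integrable f

/-- The spectral density `f(x) + x^{2n} / (1 + x²)^n g(x)` of the observed process. -/
def obsDensity (n : ℕ) (f g : ℝ → ℝ) (x : ℝ) : ℝ :=
  f x + x ^ (2 * n) / (1 + x ^ 2) ^ n * g x

/-- The denominator `(1 + x²)^n f(x) + x^{2n} g(x)` of the symbols of the operators. -/
def symbolDen (n : ℕ) (f g : ℝ → ℝ) (x : ℝ) : ℝ :=
  (1 + x ^ 2) ^ n * f x + x ^ (2 * n) * g x

/-- The minimality conditions. Division is in `[0, ∞]`, so that `c / 0 = ∞` for `c > 0`. The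
function `γ(x) = ∫_0^∞ α(t) e^{i t x} dt` is the restriction to the line of the entire function
`Γ` of exponential type, which is not identically zero. -/
def MinimalityCondition (n : ℕ) (τ : ℝ) (f g : ℝ → ℝ) : Prop :=
  ∃ (α : ℝ → ℂ) (Γ : ℂ → ℂ),
    IntegrableOn α (Ioi 0) ∧
    Differentiable ℂ Γ ∧
    (∃ K R : ℝ, ∀ z : ℂ, ‖Γ z‖ ≤ K * Real.exp (R * ‖z‖)) ∧
    (∀ x : ℝ, Γ x = ∫ t in Ioi (0 : ℝ), α t * Complex.exp (Complex.I * x * t)) ∧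
    (∃ z : ℂ, Γ z ≠ 0) ∧
    (∫⁻ x : ℝ, ENNReal.ofReal (‖Γ x‖ ^ 2) / ENNReal.ofReal (obsDensity n f g x)) < ∞ ∧
    (∫⁻ x : ℝ, ENNReal.ofReal (‖Γ x‖ ^ 2 * x ^ (2 * n) /
        (‖1 - Complex.exp (Complex.I * x * τ)‖ ^ (2 * n) * (1 + x ^ 2) ^ n)) /
      ENNReal.ofReal (obsDensity n f g x)) < ∞

/-- `A(x) = ∫_0^∞ a(t) e^{-i x t} dt`. -/
def transformA (a : ℝ → ℝ) (x : ℝ) : ℂ :=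
  ∫ t in Ioi (0 : ℝ), (a t : ℂ) * Complex.exp (-(Complex.I * x * t))

/-- `a_τ(t) = ∑_{l = max{0, ⌈-t/τ⌉}}^n (-1)^l C(n, l) a(t + τ l)`, used for `t ≥ -τ n`. -/
def aTau (n : ℕ) (τ : ℝ) (a : ℝ → ℝ) (t : ℝ) : ℝ :=
  ∑ l ∈ Finset.Icc ⌈-t / τ⌉₊ n, (-1) ^ l * (n.choose l : ℝ) * a (t + τ * l)

/-- `∫_{-τ n}^∞ a_τ(t) e^{-i x t} dt`. -/
def transformATau (n : ℕ) (τ : ℝ) (a : ℝ → ℝ) (x : ℝ) : ℂ :=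
  ∫ t in Ioi (-(τ * n)), (aTau n τ a t : ℂ) * Complex.exp (-(Complex.I * x * t))

/-! ### The operators -/

/-- The symbol of the operator `P`. -/
def symbolP (n : ℕ) (τ : ℝ) (f g : ℝ → ℝ) (x : ℝ) : ℝ :=
  x ^ (2 * n) / (‖1 - Complex.exp (Complex.I * x * τ)‖ ^ (2 * n) * symbolDen n f g x)

/-- The symbol of the operator `S`. -/
def symbolS (n : ℕ) (τ : ℝ) (f g : ℝ → ℝ) (x : ℝ) : ℝ :=
  x ^ (2 * n) * g x /
    (‖1 - Complex.exp (Complex.I * x * τ)‖ ^ (2 * n) * symbolDen n f g x)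

/-- The symbol of the operator `Q`. -/
def symbolQ (n : ℕ) (f g : ℝ → ℝ) (x : ℝ) : ℝ :=
  (1 + x ^ 2) ^ n * f x * g x / symbolDen n f g x

/-- The operator `Q`: `(Q z)(s) = ∫_0^∞ z(t) ∫ e^{i x (t - s)} symbolQ(x) dx dt`. Its symbol is
dominated by `g`, so the inner integral converges absolutely. -/
def opQ (n : ℕ) (f g : ℝ → ℝ) (z : ℝ → ℂ) (s : ℝ) : ℂ :=
  ∫ t in Ioi (0 : ℝ), z t *
    ∫ x : ℝ, Complex.exp (Complex.I * x * (t - s)) * (symbolQ n f g x : ℂ)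

/-- `⟨Q a, a⟩`, the inner product being that of `L²[0, ∞)`. -/
def innerQ (n : ℕ) (f g : ℝ → ℝ) (a : ℝ → ℝ) : ℂ :=
  ∫ s in Ioi (0 : ℝ), opQ n f g (fun t => (a t : ℂ)) s * conj (a s : ℂ)

/-- The function `y(t) = (2π)⁻¹ ∫ Y(x) e^{-i x t} dx` whose transform `∫ y(t) e^{i x t} dt`
is `Y`. -/
def timeFunction (Y : ℝ → ℂ) (t : ℝ) : ℂ :=
  (2 * Real.pi : ℂ)⁻¹ * ∫ x : ℝ, Y x * Complex.exp (-(Complex.I * x * t))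

/-- The energy `⟨P y, y⟩ = ∫ |Y(x)|² symbolP(x) dx` of the function `y` with transform `Y`,
as an element of `[0, ∞]` (the symbol is infinite where its denominator vanishes). -/
def energyP (n : ℕ) (τ : ℝ) (f g : ℝ → ℝ) (Y : ℝ → ℂ) : ℝ≥0∞ :=
  ∫⁻ x : ℝ, ENNReal.ofReal (‖Y x‖ ^ 2 *
      (x ^ (2 * n) / ‖1 - Complex.exp (Complex.I * x * τ)‖ ^ (2 * n))) /
    ENNReal.ofReal (symbolDen n f g x)

/-- The energy space of `P`, described through transforms: `Y` is the transform
`Y(x) = ∫_0^∞ y(t) e^{i x t} dt` of a function `y` carried by `[0, ∞)`, and `⟨P y, y⟩` is finite.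
Since `1 / symbolP` is bounded by an integrable function, every `y ∈ L²[0, ∞)` of finite energy
has an integrable transform and so belongs to this space, which is the completion of the set of
these `y` in the energy norm. -/
structure IsFiniteEnergy (n : ℕ) (τ : ℝ) (f g : ℝ → ℝ) (Y : ℝ → ℂ) : Prop where
  integrable : Integrable Y
  causal : ∀ t ≤ 0, timeFunction Y t = 0
  energy : energyP n τ f g Y < ∞

/-- `⟨P y, z⟩` for `y`, `z` with transforms `Y`, `Z`. The operator `P` is
`(P y)(s) = ∫_0^∞ y(t) ∫ e^{i x (t - s)} symbolP(x) dx dt`, `s ≥ 0`; the symbol of `P` is never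
integrable (the observed process has an integrable density), so `P` is an unbounded operator and
its kernel is a distribution, to be paired with `y` and `z` by integrating in `t` and `s` first. -/
def formP (n : ℕ) (τ : ℝ) (f g : ℝ → ℝ) (Y Z : ℝ → ℂ) : ℂ :=
  ∫ x : ℝ, Y x * (symbolP n τ f g x : ℂ) * conj (Z x)

/-- `⟨S a_τ, z⟩` for `z` with transform `Z`. The operator `S` is
`(S u)(s) = ∫_{-τ n}^∞ u(t) ∫ e^{-i x (t + s)} symbolS(x) dx dt`, `s ≥ 0`; as for `P`, the
integrals in `t` and `s` are taken first. -/
def formS (n : ℕ) (τ : ℝ) (a : ℝ → ℝ) (f g : ℝ → ℝ) (Z : ℝ → ℂ) : ℂ :=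
  ∫ x : ℝ, transformATau n τ a x * (symbolS n τ f g x : ℂ) * conj (Z x)

/-- `C` is the transform `C(x) = ∫_0^∞ c(t) e^{i x t} dt` of a solution `c` of finite energy of
the equation `P c = S a_τ` on `[0, ∞)`. -/
def SolvesFilterEquation (n : ℕ) (τ : ℝ) (a : ℝ → ℝ) (f g : ℝ → ℝ) (C : ℝ → ℂ) : Prop :=
  IsFiniteEnergy n τ f g C ∧
    ∀ Z, IsFiniteEnergy n τ f g Z → formP n τ f g C Z = formS n τ a f g Z

/-- The transform `C^τ(x) = ∫_0^∞ (P⁻¹ S a_τ)(t) e^{i x t} dt` of `c = P⁻¹ S a_τ`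
(unique up to null sets). -/
def filterTransform (n : ℕ) (τ : ℝ) (a : ℝ → ℝ) (f g : ℝ → ℝ) : ℝ → ℂ :=
  Classical.epsilon (SolvesFilterEquation n τ a f g)

/-- The error functional `⟨S a_τ, P⁻¹ S a_τ⟩ + ⟨Q a, a⟩`. -/
def errorFunctional (n : ℕ) (τ : ℝ) (a : ℝ → ℝ) (f g : ℝ → ℝ) : ℝ :=
  (formS n τ a f g (filterTransform n τ a f g) + innerQ n f g a).re

/-- The spectral characteristic `h_τ(f, g)`. -/
def specChar (n : ℕ) (τ : ℝ) (a : ℝ → ℝ) (f g : ℝ → ℝ) (x : ℝ) : ℂ :=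
  transformA a x * (1 + Complex.I * x) ^ n * (-(Complex.I * x)) ^ n * (g x : ℂ) /
      (symbolDen n f g x : ℂ) -
    (1 + Complex.I * x) ^ n * (-(Complex.I * x)) ^ n * filterTransform n τ a f g x /
      ((1 - Complex.exp (Complex.I * x * τ)) ^ n * (symbolDen n f g x : ℂ))

/-! ### Spectral characteristics and mean-square errors -/

/-- The measure with density `f(x) + x^{2n} / (1 + x²)^n g(x)`. -/
def obsMeasure (n : ℕ) (f g : ℝ → ℝ) : Measure ℝ :=
  volume.withDensity fun x => ENNReal.ofReal (obsDensity n f g x)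

/-- The functions `e^{i x t} (1 - e^{-i x τ})^n (1 + i x)^n / (i x)^n`, `t ≤ 0`, which represent
the observed increments. -/
def observedFunctions (n : ℕ) (τ : ℝ) : Set (ℝ → ℂ) :=
  {u | ∃ t ≤ (0 : ℝ), u = fun x : ℝ => Complex.exp (Complex.I * x * t) *
    (1 - Complex.exp (-(Complex.I * x * τ))) ^ n *
    ((1 + Complex.I * x) ^ n / (Complex.I * x) ^ n)}

/-- The closed subspace `L₂⁰` of `L₂(f + x^{2n} / (1 + x²)^n g)` generated by the observed
functions. -/
def L2Zero (n : ℕ) (τ : ℝ) (f g : ℝ → ℝ) : Set (ℝ → ℂ) :=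
  {h | MemLp h 2 (obsMeasure n f g) ∧ ∀ ε : ℝ≥0∞, 0 < ε →
    ∃ u ∈ Submodule.span ℂ (observedFunctions n τ), eLpNorm (h - u) 2 (obsMeasure n f g) < ε}

/-- The mean-square error `Δ(h; f, g)` of the estimate with spectral characteristic `h`. With
`θ = (i x)^n / (1 + i x)^n`, the error of the estimate is
`∫ A dZ_η - ∫ h (dZ_ξ + θ dZ_η) = ∫ (A - h θ) dZ_η - ∫ h dZ_ξ`, where `Z_ξ` and `Z_η` are
uncorrelated random measures with orthogonal increments and spectral densities `f` and `g`
(with respect to `dx / 2π`). -/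
def msError (n : ℕ) (a : ℝ → ℝ) (h : ℝ → ℂ) (f g : ℝ → ℝ) : ℝ≥0∞ :=
  ENNReal.ofReal (1 / (2 * Real.pi)) * ∫⁻ x : ℝ, ENNReal.ofReal
    (‖transformA a x - h x * ((Complex.I * x) ^ n / (1 + Complex.I * x) ^ n)‖ ^ 2 * g x +
      ‖h x‖ ^ 2 * f x)

/-- The mean-square error `Δ(f, g)` of the optimal estimate: the least error of estimates
with spectral characteristic in `L₂⁰`. -/
def minError (n : ℕ) (τ : ℝ) (a : ℝ → ℝ) (f g : ℝ → ℝ) : ℝ≥0∞ :=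
  ⨅ h ∈ L2Zero n τ f g, msError n a h f g

/-- `h` is the spectral characteristic of the optimal estimate. -/
def IsOptimal (n : ℕ) (τ : ℝ) (a : ℝ → ℝ) (f g : ℝ → ℝ) (h : ℝ → ℂ) : Prop :=
  h ∈ L2Zero n τ f g ∧ msError n a h f g = minError n τ a f g

/-- `(f₀, g₀)` is least favorable in `Df × Dg`. -/
def IsLeastFavorable (n : ℕ) (τ : ℝ) (a : ℝ → ℝ) (Df Dg : Set (ℝ → ℝ)) (f₀ g₀ : ℝ → ℝ) : Prop :=
  f₀ ∈ Df ∧ g₀ ∈ Dg ∧ ∀ f ∈ Df, ∀ g ∈ Dg, minError n τ a f g ≤ minError n τ a f₀ g₀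

/-- `H_D`, the intersection of the spaces `L₂⁰` over the class. -/
def HD (n : ℕ) (τ : ℝ) (Df Dg : Set (ℝ → ℝ)) : Set (ℝ → ℂ) :=
  {h | ∀ f ∈ Df, ∀ g ∈ Dg, h ∈ L2Zero n τ f g}

/-- `h₀` is a minimax-robust spectral characteristic: it lies in `H_D`, its error attains a
maximum over the class, and this maximum is least possible among characteristics in `H_D`. -/
def IsMinimaxRobust (n : ℕ) (τ : ℝ) (a : ℝ → ℝ) (Df Dg : Set (ℝ → ℝ)) (h₀ : ℝ → ℂ) : Prop :=
  h₀ ∈ HD n τ Df Dg ∧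
  (∃ f₁ ∈ Df, ∃ g₁ ∈ Dg, ∀ f ∈ Df, ∀ g ∈ Dg, msError n a h₀ f g ≤ msError n a h₀ f₁ g₁) ∧
  ∀ h ∈ HD n τ Df Dg,
    (⨆ f ∈ Df, ⨆ g ∈ Dg, msError n a h₀ f g) ≤ ⨆ f ∈ Df, ⨆ g ∈ Dg, msError n a h f g

end MinimaxFiltering

end

/-!
Write `p` for the density `obsDensity` of the observed process, `B` for the generator
`(1 - e^{-i x τ})^n (1 + i x)^n / (i x)^n` of the observed functions, and
`θ = (i x)^n / (1 + i x)^n`. Everything takes place in the Hilbert space `L²(p)`, in which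
`L2Zero` is the closed subspace `K` generated by `e^{i x t} B`, `t ≤ 0`.

Completing the square (`error_integrand_eq`) shows that `2π` times the error of `h` is
`⟨Q a, a⟩ + ‖h - v‖²` with `v = A θ̄ g / p`, so the optimal estimate is the orthogonal projection of
`v` onto `K`. The map `w ↦ w p B̄` (`toEnergy`) is an isometry of `K^⊥` onto the energy space of `P`:
orthogonality to `e^{i x t} B` says that the time function of `w p B̄` vanishes at `t`, and `|B|² p`
is the reciprocal of the symbol of `P`. Since the transform of `a_τ` is `A (1 - e^{i x τ})^n`, the
functional `⟨S a_τ, ·⟩` corresponds to the inner product with `v`. Hence the equation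
`P c = S a_τ` is always solvable, its solution corresponds to the component of `v` in `K^⊥`, the
function `specChar` is the projection of `v` onto `K`, and the error functional is `2π` times the
least error (`minError_eq`). None of this needs the minimality conditions, so a pair that maximizes
the error functional is least favorable.

For the saddle point, fix another pair of the convex class, move from the least favorable pair
towards it by a proportion `t`, and let `h_t` be optimal for the pair so obtained. The error is
affine in the densities, and the excess error of `h_t` at the least favorable pair is its squared
distance to the optimal `h₀`. As the least error does not increase, this distance is of order `√t`,
while the error of `h_t` at the other pair is at most the least favorable error
(`variation_bounds`). By the minimality conditions the least favorable density vanishes only on a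
null set, because a nonzero entire function has only a null set of real zeros; so along a sequence
`t → 0` the `h_t` converge to `h₀` almost everywhere, and Fatou's lemma bounds the error of `h₀` at
the other pair (`msError_specChar_le`).
-/

open scoped InnerProductSpace

noncomputable section

namespace MinimaxFiltering

variable {n : ℕ} {τ : ℝ} {f g f' g' a : ℝ → ℝ}

/-! ### Zeros of entire functions on the line and the observed functions -/

/-- The real zeros of an entire function that is not identically zero form a null set. -/
lemma ae_ne_zero_of_differentiable {F : ℂ → ℂ} (hF : Differentiable ℂ F) {z : ℂ} (hz : F z ≠ 0) :
    ∀ᵐ x : ℝ, F x ≠ 0 := by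
  have han : AnalyticOnNhd ℂ F univ := fun w _ => hF.analyticAt w
  have hre : AnalyticOnNhd ℝ (fun x : ℝ => F x) univ := fun x _ =>
    ((hF.analyticAt (x : ℂ)).restrictScalars (𝕜 := ℝ)).comp (Complex.ofRealCLM.analyticAt x)
  have hex : ∃ x : ℝ, F x ≠ 0 := by
    by_contra! h
    refine hz ?_
    have hfr : ∃ᶠ w in nhdsWithin (0 : ℂ) {0}ᶜ, F w = 0 := by
      have ht : Filter.Tendsto (fun k : ℕ => (((1 / ((k : ℝ) + 1) : ℝ)) : ℂ)) Filter.atTop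
          (nhdsWithin (0 : ℂ) {0}ᶜ) := by
        refine tendsto_nhdsWithin_iff.2 ⟨?_, Filter.Eventually.of_forall fun k => ?_⟩
        · have := (Complex.continuous_ofReal.tendsto 0).comp
            (tendsto_one_div_add_atTop_nhds_zero_nat (𝕜 := ℝ))
          rwa [Complex.ofReal_zero] at this
        · have : (0 : ℝ) < 1 / ((k : ℝ) + 1) := by positivity
          simpa only [mem_compl_iff, mem_singleton_iff, Complex.ofReal_eq_zero] using this.ne'
      exact ht.frequently (Filter.Frequently.of_forall fun k => h _)
    exact han.eqOn_zero_of_preconnected_of_frequently_eq_zero isPreconnected_univ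
      (mem_univ 0) hfr (mem_univ z)
  obtain ⟨x, hx⟩ := hex
  have := hre.preimage_zero_mem_codiscrete hx
  have h2 := ae_restrict_le_codiscreteWithin (μ := (volume : Measure ℝ)) MeasurableSet.univ this
  rw [Measure.restrict_univ] at h2
  exact h2

/-- The frequencies at which neither `x` nor `1 - e^{i x τ}` vanishes have full measure. -/
lemma ae_regular {τ : ℝ} (hτ : 0 < τ) :
    ∀ᵐ x : ℝ, x ≠ 0 ∧ 1 - Complex.exp (Complex.I * x * τ) ≠ 0 := by
  have h1 : ∀ᵐ x : ℝ, (1 : ℂ) - Complex.exp (Complex.I * x * τ) ≠ 0 := by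
    refine ae_ne_zero_of_differentiable (F := fun z => 1 - Complex.exp (Complex.I * z * τ))
      (by fun_prop) (z := Complex.I / τ) ?_
    have hτ' : (τ : ℂ) ≠ 0 := by exact_mod_cast hτ.ne'
    have : Complex.I * (Complex.I / τ) * τ = ((-1 : ℝ) : ℂ) := by
      field_simp; simp
    simp only [this]
    rw [← Complex.ofReal_exp, sub_ne_zero]
    intro h
    have h' : (1 : ℝ) = Real.exp (-1) := by exact_mod_cast h
    have : Real.exp (-1) < 1 := by simp
    linarith
  filter_upwards [h1, compl_mem_ae_iff.2 (measure_singleton (0 : ℝ))] with x hx hx0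
  exact ⟨hx0, hx⟩

/-- The generator `(1 - e^{-i x τ})^n (1 + i x)^n / (i x)^n` of the observed functions. -/
def observedGen (n : ℕ) (τ x : ℝ) : ℂ :=
  (1 - Complex.exp (-(Complex.I * x * τ))) ^ n * ((1 + Complex.I * x) ^ n / (Complex.I * x) ^ n)

lemma measurable_observedGen (n : ℕ) (τ : ℝ) : Measurable (observedGen n τ) := by
  unfold observedGen
  fun_prop

lemma conj_exp_neg_I_mul (x t : ℝ) :
    conj (Complex.exp (-(Complex.I * x * t))) = Complex.exp (Complex.I * x * t) := by
  rw [← Complex.exp_conj]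
  simp

lemma norm_exp_I_mul_mul (x t : ℝ) : ‖Complex.exp (Complex.I * x * t)‖ = 1 := by
  have := Complex.norm_exp_I_mul_ofReal (x * t)
  rwa [Complex.ofReal_mul, ← mul_assoc] at this

lemma norm_exp_neg_I_mul_mul (x t : ℝ) : ‖Complex.exp (-(Complex.I * x * t))‖ = 1 := by
  have := norm_exp_I_mul_mul x (-t)
  simpa using this

lemma norm_one_add_I_mul_sq (x : ℝ) : ‖1 + Complex.I * x‖ ^ 2 = 1 + x ^ 2 := by
  rw [← Complex.normSq_eq_norm_sq, Complex.normSq_apply]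
  simp
  ring

lemma norm_observedGen_le {τ : ℝ} (hτ : 0 < τ) (n : ℕ) (x : ℝ) :
    ‖observedGen n τ x‖ ≤ (τ + 2) ^ n := by
  rw [observedGen, ← div_pow, ← mul_pow, norm_pow]
  refine pow_le_pow_left₀ (norm_nonneg _) ?_ n
  rcases eq_or_ne x 0 with rfl | hx
  · simp; positivity
  have hx' : 0 < |x| := abs_pos.2 hx
  set d : ℂ := 1 - Complex.exp (-(Complex.I * x * τ)) with hd
  have h1 : ‖d‖ ≤ τ * |x| := by
    have := Real.norm_exp_I_mul_ofReal_sub_one_le (x := -(x * τ))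
    rw [norm_sub_rev] at this
    have e : Complex.I * ((-(x * τ) : ℝ) : ℂ) = -(Complex.I * x * τ) := by push_cast; ring
    rw [e] at this
    rwa [norm_neg, Real.norm_eq_abs, abs_mul, abs_of_pos hτ, mul_comm |x|] at this
  have h2 : ‖d‖ ≤ 2 := by
    refine (norm_sub_le _ _).trans ?_
    rw [norm_exp_neg_I_mul_mul]; norm_num
  have h3 : ‖1 + Complex.I * x‖ ≤ 1 + |x| := by
    refine (norm_add_le _ _).trans ?_
    simp
  have h4 : ‖Complex.I * (x : ℂ)‖ = |x| := by simp
  rw [norm_mul, norm_div, h4, ← mul_div_assoc, div_le_iff₀ hx']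
  nlinarith [norm_nonneg d, mul_le_mul_of_nonneg_left h3 (norm_nonneg d)]

lemma conj_observedGen (n : ℕ) (τ x : ℝ) :
    conj (observedGen n τ x) = (1 - Complex.exp (Complex.I * x * τ)) ^ n *
      ((1 - Complex.I * x) ^ n / (-(Complex.I * x)) ^ n) := by
  simp only [observedGen, map_mul, map_pow, map_sub, map_one, map_div₀, conj_exp_neg_I_mul,
    map_add, Complex.conj_I, Complex.conj_ofReal, neg_mul, ← sub_eq_add_neg]

lemma one_add_I_mul_ne_zero (x : ℝ) : 1 + Complex.I * x ≠ 0 := by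
  intro h
  have := congrArg Complex.re h
  simp at this

lemma one_sub_I_mul_ne_zero (x : ℝ) : 1 - Complex.I * x ≠ 0 := by
  intro h
  have := congrArg Complex.re h
  simp at this

lemma observedGen_ne_zero {n : ℕ} {τ x : ℝ} (hx : x ≠ 0)
    (hx' : 1 - Complex.exp (Complex.I * x * τ) ≠ 0) : observedGen n τ x ≠ 0 := by
  have hc : conj (observedGen n τ x) ≠ 0 := by
    rw [conj_observedGen]
    have hxc : (x : ℂ) ≠ 0 := by exact_mod_cast hx
    exact mul_ne_zero (pow_ne_zero _ hx') (div_ne_zero (pow_ne_zero _ (one_sub_I_mul_ne_zero x))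
      (pow_ne_zero _ (neg_ne_zero.2 (mul_ne_zero Complex.I_ne_zero hxc))))
  exact fun h => hc (by simp [h])

lemma norm_observedGen_sq (n : ℕ) (τ x : ℝ) :
    ‖observedGen n τ x‖ ^ 2 =
      ‖1 - Complex.exp (Complex.I * x * τ)‖ ^ (2 * n) * (1 + x ^ 2) ^ n / x ^ (2 * n) := by
  rw [← RCLike.norm_conj, conj_observedGen]
  have h2 : ‖1 - Complex.I * (x : ℂ)‖ ^ 2 = 1 + x ^ 2 := by
    have := norm_one_add_I_mul_sq (-x)
    simpa [sub_eq_add_neg] using this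
  simp only [norm_mul, norm_div, norm_pow, norm_neg, Complex.norm_I, one_mul, Complex.norm_real,
    mul_pow, div_pow]
  rw [← h2, pow_mul, pow_mul, ← sq_abs x, Real.norm_eq_abs]
  simp only [← pow_mul, mul_comm n 2]
  ring

/-! ### The observed density -/

lemma obsDensity_nonneg (hf : IsSpectralDensity f) (hg : IsSpectralDensity g) (x : ℝ) :
    0 ≤ obsDensity n f g x := by
  have h1 := hf.nonneg x
  have h2 := hg.nonneg x
  have h3 : 0 ≤ x ^ (2 * n) := by rw [pow_mul]; positivity
  unfold obsDensity
  positivity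

lemma measurable_obsDensity (hf : IsSpectralDensity f) (hg : IsSpectralDensity g) :
    Measurable (obsDensity n f g) := by
  have h1 := hf.measurable
  have h2 := hg.measurable
  unfold obsDensity
  fun_prop

lemma pow_div_le_one (n : ℕ) (x : ℝ) : x ^ (2 * n) / (1 + x ^ 2) ^ n ≤ 1 := by
  rw [div_le_one (by positivity), pow_mul]
  exact pow_le_pow_left₀ (sq_nonneg x) (by linarith) n

lemma integrable_obsDensity (hf : IsSpectralDensity f) (hg : IsSpectralDensity g) :
    Integrable (obsDensity n f g) := by
  refine Integrable.mono' (hf.integrable.add hg.integrable)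
    (measurable_obsDensity hf hg).aestronglyMeasurable (Filter.Eventually.of_forall fun x => ?_)
  rw [Real.norm_of_nonneg (obsDensity_nonneg hf hg x)]
  exact add_le_add le_rfl (mul_le_of_le_one_left (hg.nonneg x) (pow_div_le_one n x))

lemma symbolDen_eq (n : ℕ) (f g : ℝ → ℝ) (x : ℝ) :
    symbolDen n f g x = (1 + x ^ 2) ^ n * obsDensity n f g x := by
  have : (1 + x ^ 2) ^ n ≠ 0 := by positivity
  unfold symbolDen obsDensity
  field_simp

lemma eq_zero_of_obsDensity_eq_zero (hf : IsSpectralDensity f) (hg : IsSpectralDensity g)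
    {x : ℝ} (hx : x ≠ 0) (h : obsDensity n f g x = 0) : f x = 0 ∧ g x = 0 := by
  have h3 : 0 < x ^ (2 * n) := by rw [pow_mul]; positivity
  have h4 : 0 < x ^ (2 * n) / (1 + x ^ 2) ^ n := by positivity
  unfold obsDensity at h
  have h1 := hf.nonneg x
  have h2 := mul_nonneg h4.le (hg.nonneg x)
  refine ⟨by linarith, ?_⟩
  have : x ^ (2 * n) / (1 + x ^ 2) ^ n * g x = 0 := by linarith
  exact (mul_eq_zero.1 this).resolve_left h4.ne'

lemma measurable_ofReal_obsDensity (hf : IsSpectralDensity f) (hg : IsSpectralDensity g) :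
    Measurable fun x => ENNReal.ofReal (obsDensity n f g x) :=
  (measurable_obsDensity hf hg).ennreal_ofReal

lemma lintegral_obsMeasure (hf : IsSpectralDensity f) (hg : IsSpectralDensity g)
    (F : ℝ → ℝ≥0∞) :
    ∫⁻ x, F x ∂obsMeasure n f g = ∫⁻ x, ENNReal.ofReal (obsDensity n f g x) * F x :=
  lintegral_withDensity_eq_lintegral_mul_non_measurable _ (measurable_ofReal_obsDensity hf hg)
    (Filter.Eventually.of_forall fun _ => ENNReal.ofReal_lt_top) F

lemma integral_obsMeasure (hf : IsSpectralDensity f) (hg : IsSpectralDensity g)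
    (F : ℝ → ℂ) :
    ∫ x, F x ∂obsMeasure n f g = ∫ x, F x * (obsDensity n f g x : ℂ) := by
  rw [obsMeasure, integral_withDensity_eq_integral_toReal_smul
    (measurable_ofReal_obsDensity hf hg)
    (Filter.Eventually.of_forall fun _ => ENNReal.ofReal_lt_top)]
  refine integral_congr_ae (Filter.Eventually.of_forall fun x => ?_)
  simp only [ENNReal.toReal_ofReal (obsDensity_nonneg hf hg x), Complex.real_smul]
  ring

lemma integrable_obsMeasure_iff (hf : IsSpectralDensity f) (hg : IsSpectralDensity g)
    {F : ℝ → ℂ} :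
    Integrable F (obsMeasure n f g) ↔ Integrable fun x => F x * (obsDensity n f g x : ℂ) := by
  rw [obsMeasure, integrable_withDensity_iff_integrable_smul'
    (measurable_ofReal_obsDensity hf hg)
    (Filter.Eventually.of_forall fun _ => ENNReal.ofReal_lt_top)]
  refine integrable_congr (Filter.Eventually.of_forall fun x => ?_)
  simp only [ENNReal.toReal_ofReal (obsDensity_nonneg hf hg x), Complex.real_smul]
  ring

lemma isFiniteMeasure_obsMeasure (hf : IsSpectralDensity f) (hg : IsSpectralDensity g) :
    IsFiniteMeasure (obsMeasure n f g) :=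
  isFiniteMeasure_withDensity_ofReal (integrable_obsDensity hf hg).2

lemma obsMeasure_absolutelyContinuous (n : ℕ) (f g : ℝ → ℝ) : obsMeasure n f g ≪ volume :=
  withDensity_absolutelyContinuous _ _

lemma eLpNorm_two_sq {μ : Measure ℝ} (h : ℝ → ℂ) :
    eLpNorm h 2 μ ^ 2 = ∫⁻ x, ‖h x‖ₑ ^ 2 ∂μ := by
  have := eLpNorm_nnreal_pow_eq_lintegral (μ := μ) (f := h) (p := 2) two_ne_zero
  simpa using this

lemma eLpNorm_obsMeasure_sq (hf : IsSpectralDensity f) (hg : IsSpectralDensity g) (h : ℝ → ℂ) :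
    eLpNorm h 2 (obsMeasure n f g) ^ 2 =
      ∫⁻ x, ENNReal.ofReal (‖h x‖ ^ 2 * obsDensity n f g x) := by
  rw [eLpNorm_two_sq, lintegral_obsMeasure hf hg]
  refine lintegral_congr fun x => ?_
  rw [ENNReal.ofReal_mul (by positivity), mul_comm, ENNReal.ofReal_pow (norm_nonneg _),
    ofReal_norm]

/-! ### The transforms of `a` and `a_τ` and the form of `Q` -/

lemma integrableOn_mul_exp (ha : IntegrableOn a (Ioi 0)) (x : ℝ) :
    IntegrableOn (fun t => (a t : ℂ) * Complex.exp (-(Complex.I * x * t))) (Ioi 0) := by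
  refine ha.ofReal.mul_bdd (c := 1) (by fun_prop) (Filter.Eventually.of_forall fun t => ?_)
  exact (norm_exp_neg_I_mul_mul x t).le

lemma norm_transformA_le (a : ℝ → ℝ) (x : ℝ) : ‖transformA a x‖ ≤ ∫ t in Ioi (0 : ℝ), ‖a t‖ := by
  refine (norm_integral_le_integral_norm _).trans_eq (integral_congr_ae
    (Filter.Eventually.of_forall fun t => ?_))
  simp only [norm_mul, norm_exp_neg_I_mul_mul, mul_one, Complex.norm_real]

lemma continuous_transformA (ha : IntegrableOn a (Ioi 0)) : Continuous (transformA a) := by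
  refine continuous_of_dominated (bound := fun t => ‖a t‖)
    (fun x => (integrableOn_mul_exp ha x).aestronglyMeasurable)
    (fun x => Filter.Eventually.of_forall fun t => ?_) ha.norm
    (Filter.Eventually.of_forall fun t => ?_)
  · simp only [norm_mul, norm_exp_neg_I_mul_mul, mul_one, Complex.norm_real, le_refl]
  · fun_prop

lemma aTau_eq_sum_range (hτ : 0 < τ) (n : ℕ) (a : ℝ → ℝ) (t : ℝ) :
    aTau n τ a t = ∑ l ∈ Finset.range (n + 1),
      if 0 ≤ t + τ * l then (-1) ^ l * (n.choose l : ℝ) * a (t + τ * l) else 0 := by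
  rw [← Finset.sum_filter]
  refine Finset.sum_congr (Finset.ext fun l => ?_) fun _ _ => rfl
  rw [Finset.mem_Icc, Finset.mem_filter, Finset.mem_range, Nat.ceil_le, div_le_iff₀ hτ,
    Nat.lt_succ_iff, and_comm]
  refine and_congr_right fun _ => ?_
  constructor <;> intro h <;> linarith

/-- Taking the `n`th difference of `a` multiplies its transform by `(1 - e^{i x τ})^n`. -/
lemma transformATau_eq (hτ : 0 < τ) (ha : IntegrableOn a (Ioi 0)) (x : ℝ) :
    transformATau n τ a x = transformA a x * (1 - Complex.exp (Complex.I * x * τ)) ^ n := by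
  set G : ℝ → ℂ := (Ioi (0 : ℝ)).indicator
    (fun t => (a t : ℂ) * Complex.exp (-(Complex.I * x * t))) with hG
  have hGi : Integrable G := (integrable_indicator_iff measurableSet_Ioi).2
    (integrableOn_mul_exp ha x)
  have hGA : ∫ t, G t = transformA a x := integral_indicator measurableSet_Ioi
  set c : ℕ → ℂ := fun l => (-1) ^ l * (n.choose l : ℂ) * Complex.exp (Complex.I * x * τ) ^ l
    with hc
  -- `a_τ` also involves the value `a 0`, which the transform of `a` ignores.
  have hne : ∀ᵐ t : ℝ, ∀ l : ℕ, t + τ * l ≠ 0 := by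
    rw [ae_all_iff]
    intro l
    filter_upwards [compl_mem_ae_iff.2 (measure_singleton (-(τ * l)))] with t ht h
    exact ht (by rw [mem_singleton_iff]; linarith)
  have key : (Ioi (-(τ * n))).indicator
      (fun t => (aTau n τ a t : ℂ) * Complex.exp (-(Complex.I * x * t))) =ᵐ[volume]
      fun t => ∑ l ∈ Finset.range (n + 1), c l * G (t + τ * l) := by
    filter_upwards [hne] with t ht
    by_cases htn : t ∈ Ioi (-(τ * n))
    · rw [indicator_of_mem htn, aTau_eq_sum_range hτ, Complex.ofReal_sum, Finset.sum_mul]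
      refine Finset.sum_congr rfl fun l _ => ?_
      by_cases h : 0 ≤ t + τ * l
      · rw [if_pos h, hG, indicator_of_mem (show t + τ * l ∈ Ioi (0 : ℝ) from
          lt_of_le_of_ne h (ht l).symm), hc]
        have : Complex.exp (-(Complex.I * x * t)) = Complex.exp (Complex.I * x * τ) ^ l *
            Complex.exp (-(Complex.I * x * ((t + τ * l : ℝ) : ℂ))) := by
          rw [← Complex.exp_nat_mul, ← Complex.exp_add]
          congr 1
          push_cast
          ring
        rw [this]
        push_cast
        ring
      · rw [if_neg h, hG, indicator_of_notMem (s := Ioi (0 : ℝ)) (fun h' => h (le_of_lt h'))]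
        simp
    · -- For `t ≤ -τ n` every argument `t + τ l`, `l ≤ n`, is at most `0`.
      rw [indicator_of_notMem htn]
      refine (Finset.sum_eq_zero fun l hl => ?_).symm
      rw [hG, indicator_of_notMem, mul_zero]
      rw [mem_Ioi, not_lt] at htn ⊢
      have : (l : ℝ) ≤ n := by exact_mod_cast Nat.lt_succ_iff.1 (Finset.mem_range.1 hl)
      nlinarith
  rw [transformATau, ← integral_indicator measurableSet_Ioi, integral_congr_ae key,
    integral_finsetSum _ fun (l : ℕ) _ => (hGi.comp_add_right (τ * l)).const_mul (c l)]
  simp only [integral_const_mul, integral_add_right_eq_self G, hGA]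
  rw [← Finset.sum_mul, mul_comm]
  congr 1
  rw [sub_eq_neg_add, add_pow]
  refine Finset.sum_congr rfl fun l _ => ?_
  rw [hc, neg_pow (Complex.exp _), one_pow]
  ring

lemma symbolQ_nonneg (hf : IsSpectralDensity f) (hg : IsSpectralDensity g) (x : ℝ) :
    0 ≤ symbolQ n f g x := by
  have h1 := hf.nonneg x
  have h2 := hg.nonneg x
  have h3 := obsDensity_nonneg (n := n) hf hg x
  rw [symbolQ, symbolDen_eq]
  positivity

lemma symbolQ_le (hf : IsSpectralDensity f) (hg : IsSpectralDensity g) (x : ℝ) :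
    symbolQ n f g x ≤ g x := by
  have h1 := hf.nonneg x
  have h2 := hg.nonneg x
  have h3 : 0 ≤ x ^ (2 * n) := by rw [pow_mul]; positivity
  have h4 : 0 ≤ symbolDen n f g x := by unfold symbolDen; positivity
  refine div_le_of_le_mul₀ h4 h2 ?_
  unfold symbolDen
  nlinarith [mul_nonneg (mul_nonneg h3 h2) h2]

lemma measurable_symbolQ (hf : IsSpectralDensity f) (hg : IsSpectralDensity g) :
    Measurable (symbolQ n f g) := by
  have h1 := hf.measurable
  have h2 := hg.measurable
  unfold symbolQ symbolDen
  fun_prop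

lemma integrable_symbolQ (hf : IsSpectralDensity f) (hg : IsSpectralDensity g) :
    Integrable (symbolQ n f g) := by
  refine Integrable.mono' hg.integrable (measurable_symbolQ hf hg).aestronglyMeasurable
    (Filter.Eventually.of_forall fun x => ?_)
  rw [Real.norm_of_nonneg (symbolQ_nonneg hf hg x)]
  exact symbolQ_le hf hg x

lemma conj_transformA (a : ℝ → ℝ) (x : ℝ) :
    conj (transformA a x) = ∫ t in Ioi (0 : ℝ), (a t : ℂ) * Complex.exp (Complex.I * x * t) := by
  rw [transformA, ← integral_conj]
  refine integral_congr_ae (Filter.Eventually.of_forall fun t => ?_)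
  simp only [map_mul, Complex.conj_ofReal, conj_exp_neg_I_mul]

lemma integrable_prod_mul_exp (ha : IntegrableOn a (Ioi 0)) {u : ℝ → ℂ} (hu : Integrable u)
    {e : ℝ × ℝ → ℂ} (he : Measurable e) (he1 : ∀ q, ‖e q‖ ≤ 1) :
    Integrable (fun q : ℝ × ℝ => (a q.1 : ℂ) * u q.2 * e q)
      ((volume.restrict (Ioi 0)).prod volume) :=
  (ha.ofReal.mul_prod hu).mul_bdd he.aestronglyMeasurable
    (Filter.Eventually.of_forall fun q => he1 q)

lemma opQ_eq (hf : IsSpectralDensity f) (hg : IsSpectralDensity g)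
    (ha : IntegrableOn a (Ioi 0)) (s : ℝ) :
    opQ n f g (fun t => (a t : ℂ)) s =
      ∫ x : ℝ, conj (transformA a x) * (symbolQ n f g x : ℂ) *
        Complex.exp (-(Complex.I * x * s)) := by
  have hsplit : ∀ t x : ℝ, Complex.exp (Complex.I * x * (t - s)) =
      Complex.exp (Complex.I * x * t) * Complex.exp (-(Complex.I * x * s)) := fun t x => by
    rw [← Complex.exp_add]; congr 1; ring
  have hint := integrable_prod_mul_exp ha
    (integrable_symbolQ (n := n) hf hg).ofReal
    (e := fun q => Complex.exp (Complex.I * q.2 * q.1) * Complex.exp (-(Complex.I * q.2 * s)))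
    (by fun_prop)
    (fun q => by rw [norm_mul, norm_exp_I_mul_mul, norm_exp_neg_I_mul_mul, mul_one])
  have hswap := integral_integral_swap (f := fun t x : ℝ => (a t : ℂ) * (symbolQ n f g x : ℂ) *
    (Complex.exp (Complex.I * x * t) * Complex.exp (-(Complex.I * x * s)))) hint
  rw [opQ]
  calc _ = ∫ t in Ioi (0 : ℝ), ∫ x : ℝ, (a t : ℂ) * (symbolQ n f g x : ℂ) *
        (Complex.exp (Complex.I * x * t) * Complex.exp (-(Complex.I * x * s))) := by
        refine integral_congr_ae (Filter.Eventually.of_forall fun t => ?_)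
        simp only []
        rw [← integral_const_mul]
        refine integral_congr_ae (Filter.Eventually.of_forall fun x => ?_)
        simp only [hsplit]
        ring
    _ = _ := by
        rw [hswap]
        refine integral_congr_ae (Filter.Eventually.of_forall fun x => ?_)
        simp only [conj_transformA]
        rw [← integral_mul_const, ← integral_mul_const]
        refine integral_congr_ae (Filter.Eventually.of_forall fun t => ?_)
        simp only []
        ring

/-- `⟨Q a, a⟩` in the frequency domain. -/
lemma innerQ_eq (hf : IsSpectralDensity f) (hg : IsSpectralDensity g)
    (ha : IntegrableOn a (Ioi 0)) :
    innerQ n f g a = ((∫ x : ℝ, ‖transformA a x‖ ^ 2 * symbolQ n f g x : ℝ) : ℂ) := by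
  have hu : Integrable fun x : ℝ => conj (transformA a x) * (symbolQ n f g x : ℂ) :=
    (integrable_symbolQ hf hg).ofReal.bdd_mul
      (Complex.continuous_conj.comp (continuous_transformA ha)).aestronglyMeasurable
      (Filter.Eventually.of_forall fun x => by
        rw [RCLike.norm_conj]; exact norm_transformA_le a x)
  have hint := integrable_prod_mul_exp ha hu
    (e := fun q => Complex.exp (-(Complex.I * q.2 * q.1))) (by fun_prop)
    (fun q => (norm_exp_neg_I_mul_mul _ _).le)
  have hswap := integral_integral_swap (f := fun s x : ℝ => (a s : ℂ) *
    (conj (transformA a x) * (symbolQ n f g x : ℂ)) * Complex.exp (-(Complex.I * x * s))) hint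
  rw [innerQ]
  calc _ = ∫ s in Ioi (0 : ℝ), ∫ x : ℝ, (a s : ℂ) *
      (conj (transformA a x) * (symbolQ n f g x : ℂ)) * Complex.exp (-(Complex.I * x * s)) := by
        refine integral_congr_ae (Filter.Eventually.of_forall fun s => ?_)
        simp only [opQ_eq hf hg ha, Complex.conj_ofReal]
        rw [← integral_mul_const]
        refine integral_congr_ae (Filter.Eventually.of_forall fun x => ?_)
        simp only []
        ring
    _ = _ := by
        rw [hswap, ← integral_complex_ofReal]
        refine integral_congr_ae (Filter.Eventually.of_forall fun x => ?_)
        have : ((‖transformA a x‖ ^ 2 * symbolQ n f g x : ℝ) : ℂ) =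
            transformA a x * conj (transformA a x) * (symbolQ n f g x : ℂ) := by
          rw [Complex.mul_conj']; push_cast; ring
        simp only [this]
        have hpull : ∀ w : ℂ, transformA a x * w = ∫ s in Ioi (0 : ℝ),
            (a s : ℂ) * Complex.exp (-(Complex.I * x * s)) * w :=
          fun w => (integral_mul_const w _).symm
        rw [mul_assoc, hpull]
        refine integral_congr_ae (Filter.Eventually.of_forall fun s => ?_)
        simp only []
        ring

/-! ### The energy space inside `L²(p)` -/

/-- The isometry `w ↦ w p B̄`, `B` being `observedGen`. It carries the orthogonal complement of the
observed functions in `L²(p)` onto the space of transforms of finite energy. -/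
def toEnergy (n : ℕ) (τ : ℝ) (f g : ℝ → ℝ) (w : ℝ → ℂ) (x : ℝ) : ℂ :=
  w x * (obsDensity n f g x : ℂ) * conj (observedGen n τ x)

/-- The inverse `Y ↦ Y / (p B̄)` of `toEnergy`. Its value where `p` vanishes is immaterial. -/
def ofEnergy (n : ℕ) (τ : ℝ) (f g : ℝ → ℝ) (Y : ℝ → ℂ) (x : ℝ) : ℂ :=
  Y x / ((obsDensity n f g x : ℂ) * conj (observedGen n τ x))

/-- The function `A θ̄ g / p` of `L²(p)`, where `θ = (i x)^n / (1 + i x)^n`: the spectral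
characteristic that would be optimal if all of `L²(p)` were observed. -/
def unrestrictedChar (n : ℕ) (a f g : ℝ → ℝ) (x : ℝ) : ℂ :=
  transformA a x * ((-(Complex.I * x)) ^ n / (1 - Complex.I * x) ^ n) * (g x : ℂ) /
    (obsDensity n f g x : ℂ)

lemma integrable_toEnergy (hτ : 0 < τ) (hf : IsSpectralDensity f) (hg : IsSpectralDensity g)
    {w : ℝ → ℂ} (hw : MemLp w 2 (obsMeasure n f g)) : Integrable (toEnergy n τ f g w) := by
  have := isFiniteMeasure_obsMeasure (n := n) hf hg
  have h1 := (integrable_obsMeasure_iff hf hg).1 (hw.integrable one_le_two)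
  refine h1.mul_bdd (c := (τ + 2) ^ n) ?_ (Filter.Eventually.of_forall fun x => ?_)
  · exact (Complex.continuous_conj.measurable.comp
      (measurable_observedGen n τ)).aestronglyMeasurable
  · rw [RCLike.norm_conj]
    exact norm_observedGen_le hτ n x

lemma energyP_congr {Y Z : ℝ → ℂ} (h : Y =ᵐ[volume] Z) :
    energyP n τ f g Y = energyP n τ f g Z := by
  refine lintegral_congr_ae ?_
  filter_upwards [h] with x hx
  rw [hx]

lemma timeFunction_congr {Y Z : ℝ → ℂ} (h : Y =ᵐ[volume] Z) (t : ℝ) :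
    timeFunction Y t = timeFunction Z t := by
  unfold timeFunction
  congr 1
  refine integral_congr_ae ?_
  filter_upwards [h] with x hx
  rw [hx]

/-- The symbol of `P` is `1 / (|B|² p)`, so `toEnergy` preserves norms. -/
lemma energyP_toEnergy (hτ : 0 < τ) (hf : IsSpectralDensity f) (hg : IsSpectralDensity g)
    (w : ℝ → ℂ) :
    energyP n τ f g (toEnergy n τ f g w) = eLpNorm w 2 (obsMeasure n f g) ^ 2 := by
  rw [eLpNorm_obsMeasure_sq hf hg]
  refine lintegral_congr_ae ?_
  filter_upwards [ae_regular hτ] with x hx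
  -- Where `p = 0` the integrand of the energy is `0 / 0 = 0`.
  rcases eq_or_ne (obsDensity n f g x) 0 with hp | hp
  · simp [toEnergy, hp]
  have hpos : 0 < obsDensity n f g x := lt_of_le_of_ne (obsDensity_nonneg hf hg x) hp.symm
  have hden : 0 < symbolDen n f g x := by rw [symbolDen_eq]; positivity
  rw [← ENNReal.ofReal_div_of_pos hden]
  congr 1
  have hx1 : x ≠ 0 := hx.1
  have hx2 : ‖1 - Complex.exp (Complex.I * x * τ)‖ ≠ 0 := norm_ne_zero_iff.2 hx.2
  have hx3 : (1 + x ^ 2) ^ n ≠ 0 := by positivity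
  rw [toEnergy, norm_mul, norm_mul, RCLike.norm_conj, mul_pow, mul_pow, norm_observedGen_sq,
    Complex.norm_real, Real.norm_of_nonneg hpos.le, symbolDen_eq]
  field_simp

/-- A transform of finite energy vanishes where the density `p` does. -/
lemma ae_eq_zero_of_energyP_lt_top (hτ : 0 < τ) (hf : IsSpectralDensity f)
    (hg : IsSpectralDensity g) {Y : ℝ → ℂ} (hY : AEMeasurable Y)
    (hE : energyP n τ f g Y < ∞) : ∀ᵐ x, obsDensity n f g x = 0 → Y x = 0 := by
  have hden : Measurable (symbolDen n f g) := by
    have h1 := hf.measurable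
    have h2 := hg.measurable
    unfold symbolDen
    fun_prop
  have hm : AEMeasurable fun x : ℝ => ENNReal.ofReal (‖Y x‖ ^ 2 *
      (x ^ (2 * n) / ‖1 - Complex.exp (Complex.I * x * τ)‖ ^ (2 * n))) /
      ENNReal.ofReal (symbolDen n f g x) := by
    refine AEMeasurable.div (AEMeasurable.ennreal_ofReal (AEMeasurable.mul (hY.norm.pow_const 2) ?_))
      hden.ennreal_ofReal.aemeasurable
    exact Measurable.aemeasurable (by fun_prop)
  filter_upwards [ae_lt_top' hm hE.ne, ae_regular hτ] with x hx hreg hp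
  by_contra hY0
  have hx2 : 0 < ‖1 - Complex.exp (Complex.I * x * τ)‖ := norm_pos_iff.2 hreg.2
  have hx3 : 0 < x ^ (2 * n) := by
    have := hreg.1
    rw [pow_mul]; positivity
  have hpos : 0 < ‖Y x‖ ^ 2 *
      (x ^ (2 * n) / ‖1 - Complex.exp (Complex.I * x * τ)‖ ^ (2 * n)) := by
    have := norm_pos_iff.2 hY0
    positivity
  rw [symbolDen_eq, hp, mul_zero, ENNReal.ofReal_zero,
    ENNReal.div_zero (ENNReal.ofReal_pos.2 hpos).ne'] at hx
  exact lt_irrefl _ hx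

lemma toEnergy_ofEnergy (hτ : 0 < τ) (hf : IsSpectralDensity f) (hg : IsSpectralDensity g)
    {Y : ℝ → ℂ} (hY : IsFiniteEnergy n τ f g Y) :
    toEnergy n τ f g (ofEnergy n τ f g Y) =ᵐ[volume] Y := by
  filter_upwards [ae_eq_zero_of_energyP_lt_top hτ hf hg hY.integrable.aemeasurable hY.energy,
    ae_regular hτ] with x h0 hreg
  rcases eq_or_ne (obsDensity n f g x) 0 with hp | hp
  · simp [toEnergy, hp, h0 hp]
  have hB := (map_ne_zero (starRingEnd ℂ)).2 (observedGen_ne_zero (n := n) hreg.1 hreg.2)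
  have hp' : (obsDensity n f g x : ℂ) ≠ 0 := by exact_mod_cast hp
  unfold toEnergy ofEnergy
  field_simp

lemma memLp_ofEnergy (hτ : 0 < τ) (hf : IsSpectralDensity f) (hg : IsSpectralDensity g)
    {Y : ℝ → ℂ} (hY : IsFiniteEnergy n τ f g Y) :
    MemLp (ofEnergy n τ f g Y) 2 (obsMeasure n f g) := by
  refine ⟨?_, ?_⟩
  · have h1 : AEMeasurable (ofEnergy n τ f g Y) :=
      hY.integrable.aemeasurable.div ((Complex.measurable_ofReal.comp
        (measurable_obsDensity hf hg)).mul (Complex.continuous_conj.measurable.comp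
          (measurable_observedGen n τ))).aemeasurable
    exact h1.aestronglyMeasurable.mono_ac (obsMeasure_absolutelyContinuous n f g)
  · have h2 : eLpNorm (ofEnergy n τ f g Y) 2 (obsMeasure n f g) ^ 2 < ∞ := by
      rw [← energyP_toEnergy hτ hf hg, energyP_congr (toEnergy_ofEnergy hτ hf hg hY)]
      exact hY.energy
    exact (ENNReal.pow_lt_top_iff.1 h2).resolve_right two_ne_zero

/-- The values of the time function of `w p B̄` are the pairings of `w` with the observed
functions in `L²(p)`. -/
lemma timeFunction_toEnergy (hf : IsSpectralDensity f) (hg : IsSpectralDensity g)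
    (w : ℝ → ℂ) (t : ℝ) :
    timeFunction (toEnergy n τ f g w) t = (2 * Real.pi : ℂ)⁻¹ *
      ∫ x, w x * conj (Complex.exp (Complex.I * x * t) * observedGen n τ x)
        ∂obsMeasure n f g := by
  rw [integral_obsMeasure hf hg, timeFunction]
  congr 1
  refine integral_congr_ae (Filter.Eventually.of_forall fun x => ?_)
  have : conj (Complex.exp (Complex.I * x * t)) = Complex.exp (-(Complex.I * x * t)) := by
    rw [← Complex.exp_conj]; simp
  simp only [map_mul, this, toEnergy]
  ring

lemma symbolP_eq (n : ℕ) (τ : ℝ) (f g : ℝ → ℝ) {x : ℝ} (hx : x ≠ 0) :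
    symbolP n τ f g x = (‖observedGen n τ x‖ ^ 2 * obsDensity n f g x)⁻¹ := by
  rw [symbolP, norm_observedGen_sq, symbolDen_eq]
  have : (1 + x ^ 2) ^ n ≠ 0 := by positivity
  field_simp

lemma formP_toEnergy (hτ : 0 < τ) (hf : IsSpectralDensity f) (hg : IsSpectralDensity g)
    {w z Y Z : ℝ → ℂ} (hw : toEnergy n τ f g w =ᵐ[volume] Y)
    (hz : toEnergy n τ f g z =ᵐ[volume] Z) :
    formP n τ f g Y Z = ∫ x, w x * conj (z x) ∂obsMeasure n f g := by
  rw [integral_obsMeasure hf hg, formP]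
  refine integral_congr_ae ?_
  filter_upwards [hw, hz, ae_regular hτ] with x hwx hzx hreg
  rw [← hwx, ← hzx]
  rcases eq_or_ne (obsDensity n f g x) 0 with hp | hp
  · simp [toEnergy, hp]
  have hB := observedGen_ne_zero (n := n) hreg.1 hreg.2
  have hB' := (map_ne_zero (starRingEnd ℂ)).2 hB
  have hp' : (obsDensity n f g x : ℂ) ≠ 0 := by exact_mod_cast hp
  have hs : (symbolP n τ f g x : ℂ) = (observedGen n τ x * conj (observedGen n τ x) *
      (obsDensity n f g x : ℂ))⁻¹ := by
    rw [symbolP_eq n τ f g hreg.1, Complex.mul_conj']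
    push_cast
    rfl
  rw [hs]
  simp only [toEnergy, map_mul, Complex.conj_ofReal, Complex.conj_conj]
  field_simp

lemma formS_toEnergy (hτ : 0 < τ) (hf : IsSpectralDensity f) (hg : IsSpectralDensity g)
    (ha : IntegrableOn a (Ioi 0)) {z Z : ℝ → ℂ} (hz : toEnergy n τ f g z =ᵐ[volume] Z) :
    formS n τ a f g Z = ∫ x, unrestrictedChar n a f g x * conj (z x) ∂obsMeasure n f g := by
  rw [integral_obsMeasure hf hg, formS]
  refine integral_congr_ae ?_
  filter_upwards [hz, ae_regular hτ] with x hzx hreg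
  rw [← hzx, transformATau_eq hτ ha]
  rcases eq_or_ne (obsDensity n f g x) 0 with hp | hp
  · simp [toEnergy, hp]
  have hB := observedGen_ne_zero (n := n) hreg.1 hreg.2
  have hB' := (map_ne_zero (starRingEnd ℂ)).2 hB
  have hp' : (obsDensity n f g x : ℂ) ≠ 0 := by exact_mod_cast hp
  have hxc : (x : ℂ) ≠ 0 := by exact_mod_cast hreg.1
  have hix : -(Complex.I * (x : ℂ)) ≠ 0 := neg_ne_zero.2 (mul_ne_zero Complex.I_ne_zero hxc)
  have h1 := one_sub_I_mul_ne_zero x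
  have hs : (symbolS n τ f g x : ℂ) = (observedGen n τ x * conj (observedGen n τ x) *
      (obsDensity n f g x : ℂ))⁻¹ * (g x : ℂ) := by
    have e : symbolS n τ f g x = symbolP n τ f g x * g x := by
      unfold symbolS symbolP
      ring
    rw [e, symbolP_eq n τ f g hreg.1, Complex.mul_conj']
    push_cast
    rfl
  -- The transform of `a_τ` is thus `A θ̄ B̄`.
  have hd : (1 - Complex.exp (Complex.I * x * τ)) ^ n = conj (observedGen n τ x) *
      ((-(Complex.I * x)) ^ n / (1 - Complex.I * x) ^ n) := by
    rw [conj_observedGen]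
    have h2 := pow_ne_zero n h1
    have h3 := pow_ne_zero n hix
    generalize (1 - Complex.I * (x : ℂ)) ^ n = u at *
    generalize (-(Complex.I * (x : ℂ))) ^ n = r at *
    field_simp
  rw [hs, hd]
  simp only [toEnergy, unrestrictedChar, map_mul, Complex.conj_ofReal, Complex.conj_conj]
  generalize (-(Complex.I * (x : ℂ))) ^ n / (1 - Complex.I * (x : ℂ)) ^ n = θ
  field_simp

lemma specChar_ae_eq (hτ : 0 < τ) :
    specChar n τ a f g =ᵐ[volume] fun x => unrestrictedChar n a f g x -
      ofEnergy n τ f g (filterTransform n τ a f g) x := by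
  filter_upwards [ae_regular hτ] with x hreg
  have hxc : (x : ℂ) ≠ 0 := by exact_mod_cast hreg.1
  have hix : (-(Complex.I * (x : ℂ))) ^ n ≠ 0 :=
    pow_ne_zero n (neg_ne_zero.2 (mul_ne_zero Complex.I_ne_zero hxc))
  have h1 := pow_ne_zero n (one_sub_I_mul_ne_zero x)
  have h2 := pow_ne_zero n (one_add_I_mul_ne_zero x)
  have hd := pow_ne_zero n hreg.2
  have hden : (symbolDen n f g x : ℂ) = (1 + Complex.I * x) ^ n * (1 - Complex.I * x) ^ n *
      (obsDensity n f g x : ℂ) := by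
    rw [symbolDen_eq, ← mul_pow]
    push_cast
    congr 2
    linear_combination (x : ℂ) ^ 2 * Complex.I_sq
  rw [specChar, unrestrictedChar, ofEnergy, conj_observedGen, hden]
  rcases eq_or_ne (obsDensity n f g x) 0 with hp | hp
  · simp [hp]
  have hp' : (obsDensity n f g x : ℂ) ≠ 0 := by exact_mod_cast hp
  generalize (1 - Complex.exp (Complex.I * x * τ)) ^ n = d at *
  generalize (1 - Complex.I * (x : ℂ)) ^ n = u at *
  generalize (1 + Complex.I * (x : ℂ)) ^ n = v at *
  generalize (-(Complex.I * (x : ℂ))) ^ n = r at *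
  field_simp

lemma norm_theta_sq (n : ℕ) (x : ℝ) :
    ‖(-(Complex.I * (x : ℂ))) ^ n / (1 - Complex.I * x) ^ n‖ ^ 2 =
      x ^ (2 * n) / (1 + x ^ 2) ^ n := by
  have h2 : ‖1 - Complex.I * (x : ℂ)‖ ^ 2 = 1 + x ^ 2 := by
    have := norm_one_add_I_mul_sq (-x)
    simpa [sub_eq_add_neg] using this
  rw [← h2, pow_mul, ← sq_abs x]
  simp only [norm_div, norm_pow, norm_neg, norm_mul, Complex.norm_I, one_mul, Complex.norm_real,
    div_pow, Real.norm_eq_abs, ← pow_mul, mul_comm n 2]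

/-- The norm of `unrestrictedChar` is controlled by `∫ |A|² g`, because `|θ|² g ≤ p`. -/
lemma memLp_unrestrictedChar (hf : IsSpectralDensity f) (hg : IsSpectralDensity g)
    (ha : IntegrableOn a (Ioi 0)) :
    MemLp (unrestrictedChar n a f g) 2 (obsMeasure n f g) := by
  refine ⟨?_, ?_⟩
  · have h1 := (continuous_transformA ha).measurable
    have h2 := hg.measurable
    have h3 := measurable_obsDensity (n := n) hf hg
    have : Measurable (unrestrictedChar n a f g) := by
      unfold unrestrictedChar
      fun_prop
    exact this.aestronglyMeasurable
  · set M := ∫ t in Ioi (0 : ℝ), ‖a t‖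
    have h2 : eLpNorm (unrestrictedChar n a f g) 2 (obsMeasure n f g) ^ 2 < ∞ := by
      rw [eLpNorm_obsMeasure_sq hf hg]
      refine lt_of_le_of_lt (lintegral_mono fun x => ENNReal.ofReal_le_ofReal
        (show _ ≤ M ^ 2 * g x from ?_)) (hg.integrable.const_mul (M ^ 2)).lintegral_lt_top
      have hA : ‖transformA a x‖ ^ 2 ≤ M ^ 2 :=
        pow_le_pow_left₀ (norm_nonneg _) (norm_transformA_le a x) 2
      have hg0 := hg.nonneg x
      have hf0 := hf.nonneg x
      have hp0 := obsDensity_nonneg (n := n) hf hg x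
      set r := x ^ (2 * n) / (1 + x ^ 2) ^ n with hr
      have hp : obsDensity n f g x = f x + r * g x := rfl
      have hrg : r * g x ≤ obsDensity n f g x := by linarith
      have e : ‖unrestrictedChar n a f g x‖ ^ 2 * obsDensity n f g x =
          ‖transformA a x‖ ^ 2 * g x * (r * g x / obsDensity n f g x) := by
        rw [unrestrictedChar, norm_div, norm_mul, norm_mul, div_pow, mul_pow, mul_pow,
          norm_theta_sq, ← hr, Complex.norm_real, Complex.norm_real, Real.norm_of_nonneg hg0,
          Real.norm_of_nonneg hp0]
        rcases eq_or_ne (obsDensity n f g x) 0 with h0 | h0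
        · simp [h0]
        · field_simp
      rw [e]
      refine (mul_le_of_le_one_right (by positivity) (div_le_one_of_le₀ hrg hp0)).trans ?_
      exact mul_le_mul_of_nonneg_right hA hg0
    exact (ENNReal.pow_lt_top_iff.1 h2).resolve_right two_ne_zero

/-- Completing the square in the integrand of the mean-square error. -/
lemma error_integrand_eq (hf : IsSpectralDensity f) (hg : IsSpectralDensity g) (h : ℝ → ℂ)
    {x : ℝ} (hx : x ≠ 0) :
    ‖transformA a x - h x * ((Complex.I * x) ^ n / (1 + Complex.I * x) ^ n)‖ ^ 2 * g x +
      ‖h x‖ ^ 2 * f x =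
    ‖transformA a x‖ ^ 2 * symbolQ n f g x +
      ‖h x - unrestrictedChar n a f g x‖ ^ 2 * obsDensity n f g x := by
  rcases eq_or_ne (obsDensity n f g x) 0 with hp | hp
  · obtain ⟨h1, h2⟩ := eq_zero_of_obsDensity_eq_zero hf hg hx hp
    simp [hp, h1, h2, symbolQ]
  have hp' : (obsDensity n f g x : ℂ) ≠ 0 := by exact_mod_cast hp
  set θ : ℂ := (Complex.I * x) ^ n / (1 + Complex.I * x) ^ n with hθ
  have hθc : (-(Complex.I * (x : ℂ))) ^ n / (1 - Complex.I * x) ^ n = conj θ := by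
    simp [hθ, sub_eq_add_neg]
  have hr : ((x ^ (2 * n) / (1 + x ^ 2) ^ n : ℝ) : ℂ) = θ * conj θ := by
    rw [← norm_theta_sq, hθc, RCLike.norm_conj, Complex.mul_conj']
    push_cast
    rfl
  have hpe : (f x : ℂ) = obsDensity n f g x - θ * conj θ * g x := by
    rw [← hr, obsDensity]
    push_cast
    ring
  have hQ : (symbolQ n f g x : ℂ) = f x * g x / obsDensity n f g x := by
    have : symbolQ n f g x = f x * g x / obsDensity n f g x := by
      have : (1 + x ^ 2) ^ n ≠ 0 := by positivity
      rw [symbolQ, symbolDen_eq]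
      field_simp
    rw [this]
    push_cast
    rfl
  rw [← Complex.ofReal_inj]
  push_cast
  rw [hQ, unrestrictedChar, hθc, ← Complex.mul_conj', ← Complex.mul_conj', ← Complex.mul_conj',
    ← Complex.mul_conj', hpe]
  simp only [map_sub, map_mul, map_div₀, Complex.conj_ofReal, Complex.conj_conj]
  field_simp
  ring

/-- The error is a constant plus the squared distance to `unrestrictedChar` in `L²(p)`. -/
lemma msError_eq (hf : IsSpectralDensity f) (hg : IsSpectralDensity g)
    (ha : IntegrableOn a (Ioi 0)) (h : ℝ → ℂ) :
    msError n a h f g = ENNReal.ofReal (1 / (2 * Real.pi)) *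
      (ENNReal.ofReal (∫ x, ‖transformA a x‖ ^ 2 * symbolQ n f g x) +
        eLpNorm (h - unrestrictedChar n a f g) 2 (obsMeasure n f g) ^ 2) := by
  have hA := (continuous_transformA ha).measurable
  have hQ := measurable_symbolQ (n := n) hf hg
  have h0 : ∀ x, 0 ≤ ‖transformA a x‖ ^ 2 * symbolQ n f g x := fun x =>
    mul_nonneg (sq_nonneg _) (symbolQ_nonneg hf hg x)
  have hint : Integrable fun x => ‖transformA a x‖ ^ 2 * symbolQ n f g x := by
    refine (integrable_symbolQ hf hg).bdd_mul (c := (∫ t in Ioi (0 : ℝ), ‖a t‖) ^ 2)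
      (by fun_prop) (Filter.Eventually.of_forall fun x => ?_)
    rw [norm_pow, norm_norm]
    exact pow_le_pow_left₀ (norm_nonneg _) (norm_transformA_le a x) 2
  rw [msError, ofReal_integral_eq_lintegral_ofReal hint (Filter.Eventually.of_forall h0),
    eLpNorm_obsMeasure_sq hf hg, ← lintegral_add_left (by fun_prop)]
  congr 1
  refine lintegral_congr_ae ?_
  filter_upwards [compl_mem_ae_iff.2 (measure_singleton (0 : ℝ))] with x hx
  rw [error_integrand_eq hf hg h hx, ENNReal.ofReal_add (h0 x)
    (mul_nonneg (sq_nonneg _) (obsDensity_nonneg hf hg x))]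
  rfl

/-! ### The optimal estimate as an orthogonal projection -/

/-- The linear span, in the Hilbert space `L²(p)`, of the classes of the observed functions. -/
def observedSpan (n : ℕ) (τ : ℝ) (f g : ℝ → ℝ) : Submodule ℂ (Lp ℂ 2 (obsMeasure n f g)) :=
  Submodule.span ℂ {U | ∃ u ∈ observedFunctions n τ, U =ᵐ[obsMeasure n f g] u}

/-- The closed subspace of the Hilbert space `L²(p)` generated by the observed functions. -/
def observedSpace (n : ℕ) (τ : ℝ) (f g : ℝ → ℝ) : Submodule ℂ (Lp ℂ 2 (obsMeasure n f g)) :=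
  (observedSpan n τ f g).topologicalClosure

instance : CompleteSpace (observedSpace n τ f g) :=
  (Submodule.isClosed_topologicalClosure _).completeSpace_coe

lemma observedFunctions_eq (n : ℕ) (τ : ℝ) :
    observedFunctions n τ = {u | ∃ t ≤ (0 : ℝ),
      u = fun x : ℝ => Complex.exp (Complex.I * x * t) * observedGen n τ x} := by
  simp only [observedFunctions, observedGen, mul_assoc]

lemma memLp_of_mem_observedFunctions (hτ : 0 < τ) (hf : IsSpectralDensity f)
    (hg : IsSpectralDensity g) {u : ℝ → ℂ} (hu : u ∈ observedFunctions n τ) :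
    MemLp u 2 (obsMeasure n f g) := by
  have := isFiniteMeasure_obsMeasure (n := n) hf hg
  rw [observedFunctions_eq] at hu
  obtain ⟨t, -, rfl⟩ := hu
  refine MemLp.of_bound (Measurable.aestronglyMeasurable ?_) ((τ + 2) ^ n)
    (Filter.Eventually.of_forall fun x => ?_)
  · have := measurable_observedGen n τ
    fun_prop
  · rw [norm_mul, norm_exp_I_mul_mul, one_mul]
    exact norm_observedGen_le hτ n x

lemma exists_ae_eq_of_mem_span (hτ : 0 < τ) (hf : IsSpectralDensity f) (hg : IsSpectralDensity g)
    {u : ℝ → ℂ} (hu : u ∈ Submodule.span ℂ (observedFunctions n τ)) :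
    ∃ U ∈ observedSpan n τ f g, U =ᵐ[obsMeasure n f g] u := by
  induction hu using Submodule.span_induction with
  | mem u hu =>
    have hm := memLp_of_mem_observedFunctions hτ hf hg hu
    exact ⟨hm.toLp, Submodule.subset_span ⟨u, hu, hm.coeFn_toLp⟩, hm.coeFn_toLp⟩
  | zero => exact ⟨0, Submodule.zero_mem _, Lp.coeFn_zero _ _ _⟩
  | add u v _ _ hu hv =>
    obtain ⟨U, hU, hUu⟩ := hu
    obtain ⟨V, hV, hVv⟩ := hv
    exact ⟨U + V, Submodule.add_mem _ hU hV, (Lp.coeFn_add U V).trans (hUu.add hVv)⟩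
  | smul c u _ hu =>
    obtain ⟨U, hU, hUu⟩ := hu
    exact ⟨c • U, Submodule.smul_mem _ c hU, (Lp.coeFn_smul c U).trans (hUu.const_smul c)⟩

lemma exists_ae_eq_of_mem_observedSpan {U : Lp ℂ 2 (obsMeasure n f g)}
    (hU : U ∈ observedSpan n τ f g) :
    ∃ u ∈ Submodule.span ℂ (observedFunctions n τ), U =ᵐ[obsMeasure n f g] u := by
  induction hU using Submodule.span_induction with
  | mem U hU =>
    obtain ⟨u, hu, hUu⟩ := hU
    exact ⟨u, Submodule.subset_span hu, hUu⟩
  | zero => exact ⟨0, Submodule.zero_mem _, Lp.coeFn_zero _ _ _⟩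
  | add U V _ _ hU hV =>
    obtain ⟨u, hu, hUu⟩ := hU
    obtain ⟨v, hv, hVv⟩ := hV
    exact ⟨u + v, Submodule.add_mem _ hu hv, (Lp.coeFn_add U V).trans (hUu.add hVv)⟩
  | smul c U _ hU =>
    obtain ⟨u, hu, hUu⟩ := hU
    exact ⟨c • u, Submodule.smul_mem _ c hu, (Lp.coeFn_smul c U).trans (hUu.const_smul c)⟩

lemma mem_L2Zero_iff (hτ : 0 < τ) (hf : IsSpectralDensity f) (hg : IsSpectralDensity g)
    {h : ℝ → ℂ} (hm : MemLp h 2 (obsMeasure n f g)) :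
    h ∈ L2Zero n τ f g ↔ hm.toLp ∈ observedSpace n τ f g := by
  have hdist : ∀ (U : Lp ℂ 2 (obsMeasure n f g)) (u : ℝ → ℂ), U =ᵐ[obsMeasure n f g] u →
      edist hm.toLp U = eLpNorm (h - u) 2 (obsMeasure n f g) := fun U u hUu => by
    rw [Lp.edist_def]
    exact eLpNorm_congr_ae (hm.coeFn_toLp.sub hUu)
  rw [observedSpace, ← SetLike.mem_coe, Submodule.topologicalClosure_coe, EMetric.mem_closure_iff]
  constructor
  · rintro ⟨-, H⟩ ε hε
    obtain ⟨u, hu, hlt⟩ := H ε hε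
    obtain ⟨U, hU, hUu⟩ := exists_ae_eq_of_mem_span hτ hf hg hu
    exact ⟨U, hU, by rwa [hdist U u hUu]⟩
  · refine fun H => ⟨hm, fun ε hε => ?_⟩
    obtain ⟨U, hU, hlt⟩ := H ε hε
    obtain ⟨u, hu, hUu⟩ := exists_ae_eq_of_mem_observedSpan hU
    exact ⟨u, hu, by rwa [← hdist U u hUu]⟩

lemma inner_eq_integral {U W : Lp ℂ 2 (obsMeasure n f g)} {u w : ℝ → ℂ}
    (hu : U =ᵐ[obsMeasure n f g] u) (hw : W =ᵐ[obsMeasure n f g] w) :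
    ⟪U, W⟫_ℂ = ∫ x, w x * conj (u x) ∂obsMeasure n f g := by
  rw [L2.inner_def]
  refine integral_congr_ae ?_
  filter_upwards [hu, hw] with x hux hwx
  rw [hux, hwx, RCLike.inner_apply]

/-- Orthogonality to the observed functions is causality of the time function of `w p B̄`. -/
lemma mem_orthogonal_observedSpace_iff (hτ : 0 < τ) (hf : IsSpectralDensity f)
    (hg : IsSpectralDensity g) {W : Lp ℂ 2 (obsMeasure n f g)} {w : ℝ → ℂ}
    (hw : W =ᵐ[obsMeasure n f g] w) :
    W ∈ (observedSpace n τ f g)ᗮ ↔ ∀ t ≤ 0, timeFunction (toEnergy n τ f g w) t = 0 := by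
  have hpi : (2 * Real.pi : ℂ)⁻¹ ≠ 0 := by
    have := Real.pi_ne_zero
    exact inv_ne_zero (mul_ne_zero two_ne_zero (by exact_mod_cast this))
  simp only [timeFunction_toEnergy hf hg, mul_eq_zero, hpi, false_or]
  rw [observedSpace, Submodule.orthogonal_closure, Submodule.mem_orthogonal]
  constructor
  · intro H t ht
    have hu : (fun x : ℝ => Complex.exp (Complex.I * x * t) * observedGen n τ x) ∈
        observedFunctions n τ := by
      rw [observedFunctions_eq]
      exact ⟨t, ht, rfl⟩
    have hm := memLp_of_mem_observedFunctions hτ hf hg hu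
    rw [← inner_eq_integral hm.coeFn_toLp hw]
    exact H _ (Submodule.subset_span ⟨_, hu, hm.coeFn_toLp⟩)
  · intro H U hU
    induction hU using Submodule.span_induction with
    | mem U hU =>
      obtain ⟨u, hu, hUu⟩ := hU
      rw [observedFunctions_eq] at hu
      obtain ⟨t, ht, rfl⟩ := hu
      rw [inner_eq_integral hUu hw]
      exact H t ht
    | zero => exact inner_zero_left _
    | add U V _ _ hU hV => rw [inner_add_left, hU, hV, add_zero]
    | smul c U _ hU => rw [inner_smul_left, hU, mul_zero]

lemma isFiniteEnergy_toEnergy (hτ : 0 < τ) (hf : IsSpectralDensity f) (hg : IsSpectralDensity g)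
    {W : Lp ℂ 2 (obsMeasure n f g)} (hW : W ∈ (observedSpace n τ f g)ᗮ) :
    IsFiniteEnergy n τ f g (toEnergy n τ f g W) where
  integrable := integrable_toEnergy hτ hf hg (Lp.memLp W)
  causal := (mem_orthogonal_observedSpace_iff hτ hf hg (ae_eq_refl _)).1 hW
  energy := by
    rw [energyP_toEnergy hτ hf hg]
    exact ENNReal.pow_lt_top (Lp.memLp W).2

lemma ofEnergy_mem_orthogonal (hτ : 0 < τ) (hf : IsSpectralDensity f) (hg : IsSpectralDensity g)
    {Y : ℝ → ℂ} (hY : IsFiniteEnergy n τ f g Y) :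
    (memLp_ofEnergy hτ hf hg hY).toLp ∈ (observedSpace n τ f g)ᗮ := by
  rw [mem_orthogonal_observedSpace_iff hτ hf hg (MemLp.coeFn_toLp _)]
  intro t ht
  rw [timeFunction_congr (toEnergy_ofEnergy hτ hf hg hY)]
  exact hY.causal t ht

/-- The equation `P c = S a_τ` has a solution of finite energy: the image under `toEnergy` of the
component of `unrestrictedChar` orthogonal to the observed functions. -/
lemma exists_solvesFilterEquation (hτ : 0 < τ) (hf : IsSpectralDensity f)
    (hg : IsSpectralDensity g) (ha : IntegrableOn a (Ioi 0)) :
    ∃ C, SolvesFilterEquation n τ a f g C := by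
  have hv := memLp_unrestrictedChar (n := n) hf hg ha
  set K := observedSpace n τ f g
  set V : Lp ℂ 2 (obsMeasure n f g) := hv.toLp
  set W := V - K.starProjection V
  have hW : W ∈ Kᗮ := Submodule.sub_starProjection_mem_orthogonal V
  refine ⟨toEnergy n τ f g W, isFiniteEnergy_toEnergy hτ hf hg hW, fun Z hZ => ?_⟩
  have hz := memLp_ofEnergy hτ hf hg hZ
  have hzK : hz.toLp ∈ Kᗮ := ofEnergy_mem_orthogonal hτ hf hg hZ
  rw [formP_toEnergy hτ hf hg (ae_eq_refl _) (toEnergy_ofEnergy hτ hf hg hZ),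
    formS_toEnergy hτ hf hg ha (toEnergy_ofEnergy hτ hf hg hZ),
    ← inner_eq_integral hz.coeFn_toLp (ae_eq_refl _),
    ← inner_eq_integral hz.coeFn_toLp hv.coeFn_toLp, inner_sub_right,
    Submodule.inner_left_of_mem_orthogonal (Submodule.starProjection_apply_mem K V) hzK,
    sub_zero]

lemma solvesFilterEquation_filterTransform (hτ : 0 < τ) (hf : IsSpectralDensity f)
    (hg : IsSpectralDensity g) (ha : IntegrableOn a (Ioi 0)) :
    SolvesFilterEquation n τ a f g (filterTransform n τ a f g) :=
  Classical.epsilon_spec (exists_solvesFilterEquation hτ hf hg ha)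

/-- The component of `unrestrictedChar` orthogonal to the observed functions, as a function. -/
abbrev residual (n : ℕ) (τ : ℝ) (a f g : ℝ → ℝ) : ℝ → ℂ :=
  ofEnergy n τ f g (filterTransform n τ a f g)

lemma memLp_residual (hτ : 0 < τ) (hf : IsSpectralDensity f)
    (hg : IsSpectralDensity g) (ha : IntegrableOn a (Ioi 0)) :
    MemLp (residual n τ a f g) 2 (obsMeasure n f g) :=
  memLp_ofEnergy hτ hf hg (solvesFilterEquation_filterTransform hτ hf hg ha).1

/-- Whichever solution of the equation is selected, subtracting it from `unrestrictedChar` leaves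
an element of the observed space: the equation says that the difference is orthogonal to the
orthogonal complement of that space. -/
lemma unrestrictedChar_sub_residual_mem (hτ : 0 < τ) (hf : IsSpectralDensity f)
    (hg : IsSpectralDensity g) (ha : IntegrableOn a (Ioi 0)) :
    (memLp_unrestrictedChar (n := n) hf hg ha).toLp - (memLp_residual hτ hf hg ha).toLp ∈
      observedSpace n τ f g := by
  rw [← Submodule.orthogonal_orthogonal (observedSpace n τ f g), Submodule.mem_orthogonal]
  intro W hW
  obtain ⟨hC, hsol⟩ := solvesFilterEquation_filterTransform (n := n) hτ hf hg ha
  have h := hsol _ (isFiniteEnergy_toEnergy hτ hf hg hW)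
  rw [formP_toEnergy hτ hf hg (toEnergy_ofEnergy hτ hf hg hC) (ae_eq_refl _),
    formS_toEnergy hτ hf hg ha (ae_eq_refl _)] at h
  rw [inner_sub_right, inner_eq_integral (ae_eq_refl _) (MemLp.coeFn_toLp _),
    inner_eq_integral (ae_eq_refl _) (MemLp.coeFn_toLp _), h, sub_self]

lemma specChar_ae_eq_obsMeasure (hτ : 0 < τ) :
    specChar n τ a f g =ᵐ[obsMeasure n f g] unrestrictedChar n a f g - residual n τ a f g :=
  (obsMeasure_absolutelyContinuous n f g).ae_le (specChar_ae_eq hτ)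

lemma specChar_mem_L2Zero (hτ : 0 < τ) (hf : IsSpectralDensity f)
    (hg : IsSpectralDensity g) (ha : IntegrableOn a (Ioi 0)) :
    specChar n τ a f g ∈ L2Zero n τ f g := by
  have hv := memLp_unrestrictedChar (n := n) hf hg ha
  have hu := memLp_residual (n := n) hτ hf hg ha
  have hs : MemLp (specChar n τ a f g) 2 (obsMeasure n f g) :=
    (hv.sub hu).ae_eq (specChar_ae_eq_obsMeasure hτ).symm
  rw [mem_L2Zero_iff hτ hf hg hs]
  have : hs.toLp = hv.toLp - hu.toLp := by
    rw [← MemLp.toLp_sub hv hu, MemLp.toLp_eq_toLp_iff]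
    exact specChar_ae_eq_obsMeasure hτ
  rw [this]
  exact unrestrictedChar_sub_residual_mem hτ hf hg ha

lemma eLpNorm_sub_unrestrictedChar_sq (hτ : 0 < τ) (hf : IsSpectralDensity f)
    (hg : IsSpectralDensity g) (ha : IntegrableOn a (Ioi 0)) {h : ℝ → ℂ}
    (hh : h ∈ L2Zero n τ f g) :
    eLpNorm (h - unrestrictedChar n a f g) 2 (obsMeasure n f g) ^ 2 =
      eLpNorm (h - specChar n τ a f g) 2 (obsMeasure n f g) ^ 2 +
        eLpNorm (residual n τ a f g) 2 (obsMeasure n f g) ^ 2 := by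
  have hv := memLp_unrestrictedChar (n := n) hf hg ha
  have hu := memLp_residual (n := n) hτ hf hg ha
  have hs : MemLp (specChar n τ a f g) 2 (obsMeasure n f g) :=
    (specChar_mem_L2Zero hτ hf hg ha).1
  have hm : MemLp h 2 (obsMeasure n f g) := hh.1
  have hsK := (mem_L2Zero_iff hτ hf hg hs).1 (specChar_mem_L2Zero hτ hf hg ha)
  have hhK := (mem_L2Zero_iff hτ hf hg hm).1 hh
  have huK := ofEnergy_mem_orthogonal hτ hf hg
    (solvesFilterEquation_filterTransform (n := n) hτ hf hg ha).1
  have hnorm : ∀ {w : ℝ → ℂ} (hw : MemLp w 2 (obsMeasure n f g)),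
      eLpNorm w 2 (obsMeasure n f g) ^ 2 = ENNReal.ofReal (‖hw.toLp‖ * ‖hw.toLp‖) := fun hw => by
    rw [← sq, ENNReal.ofReal_pow (norm_nonneg _), Lp.norm_toLp,
      ENNReal.ofReal_toReal hw.eLpNorm_ne_top]
  have hsplit : (hm.sub hv).toLp = (hm.sub hs).toLp - hu.toLp := by
    rw [← MemLp.toLp_sub (hm.sub hs) hu, MemLp.toLp_eq_toLp_iff]
    filter_upwards [specChar_ae_eq_obsMeasure (n := n) (a := a) (f := f) (g := g) hτ] with x hx
    simp only [Pi.sub_apply] at hx ⊢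
    rw [hx]
    ring
  have horth : ⟪(hm.sub hs).toLp, -hu.toLp⟫_ℂ = 0 := by
    rw [MemLp.toLp_sub hm hs, inner_neg_right, neg_eq_zero]
    exact Submodule.inner_right_of_mem_orthogonal (Submodule.sub_mem _ hhK hsK) huK
  rw [hnorm (hm.sub hv), hnorm (hm.sub hs), hnorm hu, hsplit, sub_eq_add_neg,
    norm_add_sq_eq_norm_sq_add_norm_sq_of_inner_eq_zero _ _ horth, norm_neg,
    ENNReal.ofReal_add (by positivity) (by positivity)]

/-- Pythagoras: the excess error of an estimate over that of `specChar` is the squared distance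
in `L²(p)`. -/
lemma msError_eq_add (hτ : 0 < τ) (hf : IsSpectralDensity f)
    (hg : IsSpectralDensity g) (ha : IntegrableOn a (Ioi 0)) {h : ℝ → ℂ}
    (hh : h ∈ L2Zero n τ f g) :
    msError n a h f g = msError n a (specChar n τ a f g) f g +
      ENNReal.ofReal (1 / (2 * Real.pi)) *
        eLpNorm (h - specChar n τ a f g) 2 (obsMeasure n f g) ^ 2 := by
  rw [msError_eq hf hg ha, msError_eq hf hg ha, eLpNorm_sub_unrestrictedChar_sq hτ hf hg ha hh,
    eLpNorm_sub_unrestrictedChar_sq hτ hf hg ha (specChar_mem_L2Zero hτ hf hg ha), sub_self,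
    eLpNorm_zero]
  ring

lemma isOptimal_specChar (hτ : 0 < τ) (hf : IsSpectralDensity f)
    (hg : IsSpectralDensity g) (ha : IntegrableOn a (Ioi 0)) :
    IsOptimal n τ a f g (specChar n τ a f g) := by
  have hmem := specChar_mem_L2Zero (n := n) hτ hf hg ha
  refine ⟨hmem, le_antisymm (le_iInf₂ fun h hh => ?_) (iInf₂_le _ hmem)⟩
  rw [msError_eq_add hτ hf hg ha hh]
  exact le_self_add

/-- The error functional is `2π` times the least mean-square error. -/
lemma minError_eq (hτ : 0 < τ) (hf : IsSpectralDensity f)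
    (hg : IsSpectralDensity g) (ha : IntegrableOn a (Ioi 0)) :
    minError n τ a f g = ENNReal.ofReal (1 / (2 * Real.pi)) *
      ENNReal.ofReal (errorFunctional n τ a f g) := by
  have hmem := specChar_mem_L2Zero (n := n) hτ hf hg ha
  have hu := memLp_residual (n := n) hτ hf hg ha
  obtain ⟨hC, hsol⟩ := solvesFilterEquation_filterTransform (n := n) hτ hf hg ha
  have hS : formS n τ a f g (filterTransform n τ a f g) = ((‖hu.toLp‖ ^ 2 : ℝ) : ℂ) := by
    rw [← hsol _ hC, formP_toEnergy hτ hf hg (toEnergy_ofEnergy hτ hf hg hC)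
      (toEnergy_ofEnergy hτ hf hg hC), ← inner_eq_integral hu.coeFn_toLp hu.coeFn_toLp,
      inner_self_eq_norm_sq_to_K]
    push_cast
    rfl
  have hQ : 0 ≤ ∫ x, ‖transformA a x‖ ^ 2 * symbolQ n f g x :=
    integral_nonneg fun x => mul_nonneg (sq_nonneg _) (symbolQ_nonneg hf hg x)
  have hE : errorFunctional n τ a f g =
      (∫ x, ‖transformA a x‖ ^ 2 * symbolQ n f g x) + ‖hu.toLp‖ ^ 2 := by
    rw [errorFunctional, hS, innerQ_eq hf hg ha, ← Complex.ofReal_add, Complex.ofReal_re, add_comm]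
  rw [← (isOptimal_specChar hτ hf hg ha).2, msError_eq hf hg ha,
    eLpNorm_sub_unrestrictedChar_sq hτ hf hg ha hmem, sub_self, eLpNorm_zero, hE,
    ENNReal.ofReal_add hQ (by positivity), ENNReal.ofReal_pow (norm_nonneg _), Lp.norm_toLp,
    ENNReal.ofReal_toReal hu.eLpNorm_ne_top]
  simp

lemma minError_lt_top (hτ : 0 < τ) (hf : IsSpectralDensity f)
    (hg : IsSpectralDensity g) (ha : IntegrableOn a (Ioi 0)) : minError n τ a f g < ∞ := by
  rw [minError_eq hτ hf hg ha]
  exact ENNReal.mul_lt_top ENNReal.ofReal_lt_top ENNReal.ofReal_lt_top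

/-! ### Variation of the densities -/

/-- Under the minimality conditions the density `p` is positive almost everywhere. -/
lemma MinimalityCondition.ae_obsDensity_ne_zero (hf : IsSpectralDensity f)
    (hg : IsSpectralDensity g) (hmin : MinimalityCondition n τ f g) :
    ∀ᵐ x, obsDensity n f g x ≠ 0 := by
  obtain ⟨α, Γ, -, hΓ, -, -, ⟨z, hz⟩, hfin, -⟩ := hmin
  have hc := hΓ.continuous
  have hm : Measurable fun x : ℝ => ENNReal.ofReal (‖Γ x‖ ^ 2) /
      ENNReal.ofReal (obsDensity n f g x) := by
    have := measurable_ofReal_obsDensity (n := n) hf hg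
    exact Measurable.div (by fun_prop) this
  filter_upwards [ae_lt_top hm hfin.ne, ae_ne_zero_of_differentiable hΓ hz] with x hx hΓx hp
  have hpos : 0 < ‖Γ x‖ ^ 2 := by
    have := norm_pos_iff.2 hΓx
    positivity
  rw [hp, ENNReal.ofReal_zero, ENNReal.div_zero (ENNReal.ofReal_pos.2 hpos).ne'] at hx
  exact lt_irrefl _ hx

/-- A smaller density has a larger observed space. -/
lemma L2Zero_subset {c : ℝ} (hc : 0 < c)
    (hle : ∀ x, c * obsDensity n f g x ≤ obsDensity n f' g' x) :
    L2Zero n τ f' g' ⊆ L2Zero n τ f g := by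
  set K := ENNReal.ofReal c⁻¹ with hK
  have hK0 : K ≠ 0 := (ENNReal.ofReal_pos.2 (inv_pos.2 hc)).ne'
  have hKt : K ≠ ∞ := ENNReal.ofReal_ne_top
  have hμ : obsMeasure n f g ≤ K • obsMeasure n f' g' := by
    rw [obsMeasure, obsMeasure, ← withDensity_smul' _ _ hKt]
    refine withDensity_mono (Filter.Eventually.of_forall fun x => ?_)
    rw [Pi.smul_apply, smul_eq_mul, hK, ← ENNReal.ofReal_mul (inv_nonneg.2 hc.le)]
    refine ENNReal.ofReal_le_ofReal ?_
    rw [inv_mul_eq_div, le_div_iff₀ hc, mul_comm]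
    exact hle x
  rintro h ⟨hm, H⟩
  refine ⟨hm.of_measure_le_smul hKt hμ, fun ε hε => ?_⟩
  set L := K ^ (1 / (2 : ℝ≥0∞)).toReal with hL
  have hL0 : L ≠ 0 := (ENNReal.rpow_pos (pos_iff_ne_zero.2 hK0) hKt).ne'
  have hLt : L ≠ ∞ := ENNReal.rpow_ne_top_of_nonneg ENNReal.toReal_nonneg hKt
  obtain ⟨u, hu, hlt⟩ := H (ε / L) (ENNReal.div_pos hε.ne' hLt)
  refine ⟨u, hu, lt_of_le_of_lt (eLpNorm_mono_measure _ hμ) ?_⟩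
  rw [eLpNorm_smul_measure_of_ne_top ENNReal.ofNat_ne_top, smul_eq_mul, ← hL, mul_comm]
  exact (ENNReal.lt_div_iff_mul_lt (Or.inl hL0) (Or.inl hLt)).1 hlt

lemma obsDensity_combination (n : ℕ) (f g f' g' : ℝ → ℝ) (s t x : ℝ) :
    obsDensity n (s • f + t • f') (s • g + t • g') x =
      s * obsDensity n f g x + t * obsDensity n f' g' x := by
  simp only [obsDensity, Pi.add_apply, Pi.smul_apply, smul_eq_mul]
  ring

/-- The error of a fixed estimate is affine in the pair of densities. As the estimate need not be
measurable, only one inequality holds without further conditions, and it is the one needed. -/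
lemma le_msError_combination (hf : IsSpectralDensity f) (hg : IsSpectralDensity g)
    (hf' : IsSpectralDensity f') (hg' : IsSpectralDensity g') (h : ℝ → ℂ) {s t : ℝ}
    (hs : 0 ≤ s) (ht : 0 ≤ t) :
    ENNReal.ofReal s * msError n a h f g + ENNReal.ofReal t * msError n a h f' g' ≤
      msError n a h (s • f + t • f') (s • g + t • g') := by
  unfold msError
  rw [mul_left_comm, mul_left_comm (ENNReal.ofReal t), ← mul_add]
  refine mul_le_mul_right ?_ _
  rw [← lintegral_const_mul' _ _ ENNReal.ofReal_ne_top,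
    ← lintegral_const_mul' _ _ ENNReal.ofReal_ne_top]
  refine (le_lintegral_add _ _).trans_eq (lintegral_congr fun x => ?_)
  have h1 := hf.nonneg x
  have h2 := hg.nonneg x
  have h3 := hf'.nonneg x
  have h4 := hg'.nonneg x
  rw [← ENNReal.ofReal_mul hs, ← ENNReal.ofReal_mul ht,
    ← ENNReal.ofReal_add (by positivity) (by positivity)]
  congr 1
  simp only [Pi.add_apply, Pi.smul_apply, smul_eq_mul]
  ring

/-- Lower semicontinuity of the error under convergence almost everywhere. -/
lemma msError_le_of_tendsto_ae (hf : IsSpectralDensity f) (hg : IsSpectralDensity g)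
    (ha : IntegrableOn a (Ioi 0)) {h : ℕ → ℝ → ℂ} {h₀ : ℝ → ℂ}
    (hm : ∀ k, AEMeasurable (h k))
    (hlim : ∀ᵐ x, Filter.Tendsto (fun k => h k x) Filter.atTop (nhds (h₀ x)))
    {M : ℝ≥0∞} (hM : ∀ k, msError n a (h k) f g ≤ M) : msError n a h₀ f g ≤ M := by
  have hpi : 0 < 1 / (2 * Real.pi) := by positivity
  set c := ENNReal.ofReal (1 / (2 * Real.pi)) with hc
  have hc0 : c ≠ 0 := (ENNReal.ofReal_pos.2 hpi).ne'
  have hct : c ≠ ∞ := ENNReal.ofReal_ne_top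
  set F : (ℝ → ℂ) → ℝ → ℝ≥0∞ := fun u x => ENNReal.ofReal
    (‖transformA a x - u x * ((Complex.I * x) ^ n / (1 + Complex.I * x) ^ n)‖ ^ 2 * g x +
      ‖u x‖ ^ 2 * f x) with hF
  have hms : ∀ u, msError n a u f g = c * ∫⁻ x, F u x := fun u => rfl
  have hFm : ∀ k, AEMeasurable (F (h k)) := fun k => by
    have h1 := hm k
    have h2 := (continuous_transformA ha).measurable
    have h3 := hf.measurable
    have h4 := hg.measurable
    rw [hF]
    fun_prop
  have hFlim : ∀ᵐ x, F h₀ x = Filter.liminf (fun k => F (h k) x) Filter.atTop := by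
    filter_upwards [hlim] with x hx
    refine (Filter.Tendsto.liminf_eq ?_).symm
    refine ENNReal.tendsto_ofReal ?_
    exact (((tendsto_const_nhds.sub (hx.mul_const _)).norm.pow 2).mul_const _).add
      ((hx.norm.pow 2).mul_const _)
  rw [hms, ENNReal.mul_le_iff_le_inv hc0 hct, lintegral_congr_ae hFlim]
  refine (lintegral_liminf_le' hFm).trans (Filter.liminf_le_of_le (by isBoundedDefault) ?_)
  intro b hb
  obtain ⟨k, hk⟩ := hb.exists
  refine hk.trans ?_
  rw [← ENNReal.mul_le_iff_le_inv hc0 hct, ← hms]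
  exact hM k

/-! ### The saddle point -/

/-- First variation at a least favorable pair: the estimate that is optimal for
`(1 - t) (f, g) + t (f', g')` has at `(f', g')` an error at most the least favorable one, and its
distance in `L²(p)` to the estimate optimal for `(f, g)` is of order `√t`. -/
lemma variation_bounds (hτ : 0 < τ) (ha : IntegrableOn a (Ioi 0))
    (hf : IsSpectralDensity f) (hg : IsSpectralDensity g)
    (hf' : IsSpectralDensity f') (hg' : IsSpectralDensity g') {t : ℝ} (ht : 0 < t)
    (ht2 : t ≤ 1 / 2)
    (hft : IsSpectralDensity ((1 - t) • f + t • f'))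
    (hgt : IsSpectralDensity ((1 - t) • g + t • g'))
    (hle : minError n τ a ((1 - t) • f + t • f') ((1 - t) • g + t • g') ≤ minError n τ a f g)
    {h : ℝ → ℂ}
    (hh : h = specChar n τ a ((1 - t) • f + t • f') ((1 - t) • g + t • g')) :
    h ∈ L2Zero n τ f g ∧ msError n a h f' g' ≤ minError n τ a f g ∧
      ENNReal.ofReal (1 / 2 * (1 / (2 * Real.pi))) *
        eLpNorm (h - specChar n τ a f g) 2 (obsMeasure n f g) ^ 2 ≤
        ENNReal.ofReal t * minError n τ a f g := by
  have hopt := isOptimal_specChar (n := n) hτ hft hgt ha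
  rw [← hh] at hopt
  have hmem : h ∈ L2Zero n τ f g := by
    refine L2Zero_subset (c := 1 - t) (by linarith) (fun x => ?_) hopt.1
    rw [obsDensity_combination]
    exact le_add_of_nonneg_right (mul_nonneg ht.le (obsDensity_nonneg hf' hg' x))
  have hΔ := (minError_lt_top (n := n) hτ hf hg ha).ne
  have hadd := msError_eq_add hτ hf hg ha hmem
  rw [(isOptimal_specChar hτ hf hg ha).2] at hadd
  have h1 := le_msError_combination (n := n) (a := a) hf hg hf' hg' h
    (show 0 ≤ 1 - t by linarith) ht.le
  rw [hopt.2] at h1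
  replace h1 := h1.trans hle
  set Δ := minError n τ a f g
  set D := eLpNorm (h - specChar n τ a f g) 2 (obsMeasure n f g) ^ 2
  have hsum : ENNReal.ofReal (1 - t) * Δ + ENNReal.ofReal t * Δ = Δ := by
    rw [← add_mul, ← ENNReal.ofReal_add (by linarith) ht.le]
    simp
  -- Both summands on the left are nonnegative, and each yields one of the bounds.
  have h2 : ENNReal.ofReal (1 - t) * (ENNReal.ofReal (1 / (2 * Real.pi)) * D) +
      ENNReal.ofReal t * msError n a h f' g' ≤ ENNReal.ofReal t * Δ := by
    refine (ENNReal.add_le_add_iff_left (a := ENNReal.ofReal (1 - t) * Δ)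
      (ENNReal.mul_ne_top ENNReal.ofReal_ne_top hΔ)).1 ?_
    rw [hsum, ← add_assoc, ← mul_add, ← hadd]
    exact h1
  refine ⟨hmem, ?_, ?_⟩
  · exact (ENNReal.mul_le_mul_iff_right (ENNReal.ofReal_pos.2 ht).ne' ENNReal.ofReal_ne_top).1
      (le_add_self.trans h2)
  · refine le_trans ?_ (le_self_add.trans h2)
    rw [ENNReal.ofReal_mul (by norm_num), mul_assoc]
    exact mul_le_mul_left (ENNReal.ofReal_le_ofReal (by linarith)) _

/-- On a convex class the estimate optimal at a least favorable pair has its largest error there,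
provided that the density of that pair vanishes only on a null set. -/
lemma msError_specChar_le (hτ : 0 < τ) (ha : IntegrableOn a (Ioi 0)) {Df Dg : Set (ℝ → ℝ)}
    (hDf : ∀ f ∈ Df, IsSpectralDensity f) (hDg : ∀ g ∈ Dg, IsSpectralDensity g)
    (hcf : Convex ℝ Df) (hcg : Convex ℝ Dg) (hlf : IsLeastFavorable n τ a Df Dg f g)
    (hp : ∀ᵐ x, obsDensity n f g x ≠ 0) (hf' : f' ∈ Df) (hg' : g' ∈ Dg) :
    msError n a (specChar n τ a f g) f' g' ≤ minError n τ a f g := by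
  obtain ⟨hf, hg, hmax⟩ := hlf
  have hΔ := (minError_lt_top (n := n) hτ (hDf f hf) (hDg g hg) ha).ne
  set t : ℕ → ℝ := fun k => 1 / ((k : ℝ) + 2) with ht
  have ht0 : ∀ k, 0 < t k := fun k => by simp only [ht]; positivity
  have ht2 : ∀ k, t k ≤ 1 / 2 := fun k =>
    one_div_le_one_div_of_le two_pos (by have := Nat.cast_nonneg (α := ℝ) k; linarith)
  have htlim : Filter.Tendsto t Filter.atTop (nhds 0) := by
    have := (tendsto_one_div_add_atTop_nhds_zero_nat (𝕜 := ℝ)).comp (Filter.tendsto_add_atTop_nat 1)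
    refine this.congr fun k => ?_
    simp only [Function.comp, ht]
    push_cast
    ring
  have hfk : ∀ k, (1 - t k) • f + t k • f' ∈ Df := fun k =>
    hcf hf hf' (by linarith [ht2 k]) (ht0 k).le (by ring)
  have hgk : ∀ k, (1 - t k) • g + t k • g' ∈ Dg := fun k =>
    hcg hg hg' (by linarith [ht2 k]) (ht0 k).le (by ring)
  obtain ⟨h, hh⟩ : ∃ h : ℕ → ℝ → ℂ, ∀ k, h k =
      specChar n τ a ((1 - t k) • f + t k • f') ((1 - t k) • g + t k • g') := ⟨_, fun _ => rfl⟩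
  have hvar := fun k => variation_bounds (n := n) (a := a) hτ ha (hDf f hf) (hDg g hg) (hDf f' hf')
    (hDg g' hg') (ht0 k) (ht2 k) (hDf _ (hfk k)) (hDg _ (hgk k)) (hmax _ (hfk k) _ (hgk k)) (hh k)
  set c := ENNReal.ofReal (1 / 2 * (1 / (2 * Real.pi))) with hc
  have hc0 : c ≠ 0 := (ENNReal.ofReal_pos.2 (by positivity)).ne'
  have hct : c ≠ ∞ := ENNReal.ofReal_ne_top
  have hD : Filter.Tendsto
      (fun k => eLpNorm (h k - specChar n τ a f g) 2 (obsMeasure n f g) ^ 2)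
      Filter.atTop (nhds 0) := by
    refine tendsto_of_tendsto_of_tendsto_of_le_of_le
      (h := fun k => c⁻¹ * (ENNReal.ofReal (t k) * minError n τ a f g))
      tendsto_const_nhds ?_ (fun _ => zero_le)
      (fun k => (ENNReal.mul_le_iff_le_inv hc0 hct).1 (hvar k).2.2)
    have h1 : Filter.Tendsto (fun k => ENNReal.ofReal (t k)) Filter.atTop (nhds 0) := by
      simpa using ENNReal.tendsto_ofReal htlim
    have h2 := ENNReal.Tendsto.const_mul (a := c⁻¹)
      (ENNReal.Tendsto.mul_const (b := minError n τ a f g) h1 (Or.inr hΔ))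
      (Or.inr (ENNReal.inv_ne_top.2 hc0))
    simpa using h2
  have hnorm : Filter.Tendsto
      (fun k => eLpNorm (h k - specChar n τ a f g) 2 (obsMeasure n f g))
      Filter.atTop (nhds 0) := by
    have h1 := ((ENNReal.continuous_rpow_const (y := (2 : ℝ)⁻¹)).tendsto 0).comp hD
    rw [ENNReal.zero_rpow_of_pos (by norm_num)] at h1
    refine h1.congr fun k => ?_
    simp only [Function.comp]
    rw [← ENNReal.rpow_natCast, ← ENNReal.rpow_mul]
    norm_num
  -- Here `p > 0` is needed: the `L²(p)` limit gives convergence only `p dx`-almost everywhere.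
  have hac : (volume : Measure ℝ) ≪ obsMeasure n f g :=
    withDensity_absolutelyContinuous' (measurable_ofReal_obsDensity (hDf f hf)
      (hDg g hg)).aemeasurable (by
        filter_upwards [hp] with x hx
        exact (ENNReal.ofReal_pos.2
          (lt_of_le_of_ne (obsDensity_nonneg (hDf f hf) (hDg g hg) x) hx.symm)).ne')
  obtain ⟨ns, -, hns⟩ := (tendstoInMeasure_of_tendsto_eLpNorm two_ne_zero
    (fun k => (hvar k).1.1.1) (specChar_mem_L2Zero hτ (hDf f hf) (hDg g hg) ha).1.1
    hnorm).exists_seq_tendsto_ae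
  exact msError_le_of_tendsto_ae (hDf f' hf') (hDg g' hg') ha
    (fun k => ((hvar (ns k)).1.1.1.mono_ac hac).aemeasurable) (hac.ae_le hns)
    (fun k => (hvar (ns k)).2.1)

/-- A pair that maximizes the error functional is least favorable. -/
lemma isLeastFavorable_of_errorFunctional_le (hτ : 0 < τ) (ha : IntegrableOn a (Ioi 0))
    {Df Dg : Set (ℝ → ℝ)} (hDf : ∀ f ∈ Df, IsSpectralDensity f)
    (hDg : ∀ g ∈ Dg, IsSpectralDensity g) (hf : f ∈ Df) (hg : g ∈ Dg)
    (hmax : ∀ f' ∈ Df, ∀ g' ∈ Dg, errorFunctional n τ a f' g' ≤ errorFunctional n τ a f g) :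
    IsLeastFavorable n τ a Df Dg f g := by
  refine ⟨hf, hg, fun f' hf' g' hg' => ?_⟩
  rw [minError_eq hτ (hDf f' hf') (hDg g' hg') ha, minError_eq hτ (hDf f hf) (hDg g hg) ha]
  exact mul_le_mul_right (ENNReal.ofReal_le_ofReal (hmax f' hf' g' hg')) _

lemma isMinimaxRobust_of_msError_le {Df Dg : Set (ℝ → ℝ)} {h₀ : ℝ → ℂ} (hf : f ∈ Df)
    (hg : g ∈ Dg) (hh : h₀ ∈ HD n τ Df Dg) (hopt : IsOptimal n τ a f g h₀)
    (hle : ∀ f' ∈ Df, ∀ g' ∈ Dg, msError n a h₀ f' g' ≤ minError n τ a f g) :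
    IsMinimaxRobust n τ a Df Dg h₀ := by
  refine ⟨hh, ⟨f, hf, g, hg, fun f' hf' g' hg' => (hle f' hf' g' hg').trans_eq hopt.2.symm⟩,
    fun h hhD => ?_⟩
  calc (⨆ f' ∈ Df, ⨆ g' ∈ Dg, msError n a h₀ f' g')
      ≤ minError n τ a f g :=
        iSup₂_le fun f' hf' => iSup₂_le fun g' hg' => hle f' hf' g' hg'
    _ ≤ msError n a h f g := iInf₂_le h (hhD f hf g hg)
    _ ≤ ⨆ f' ∈ Df, ⨆ g' ∈ Dg, msError n a h f' g' :=
        le_trans (le_iSup₂ (f := fun g' (_ : g' ∈ Dg) => msError n a h f g') g hg)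
          (le_iSup₂ (f := fun f' (_ : f' ∈ Df) => ⨆ g' ∈ Dg, msError n a h f' g') f hf)

end MinimaxFiltering

end

theorem mainTheorem3 (n : ℕ) (τ : ℝ) (hτ : 0 < τ)
    (a : ℝ → ℝ) (ha : MeasureTheory.IntegrableOn a (Set.Ioi 0))
    (Df Dg : Set (ℝ → ℝ))
    (hDf : ∀ f ∈ Df, MinimaxFiltering.IsSpectralDensity f)
    (hDg : ∀ g ∈ Dg, MinimaxFiltering.IsSpectralDensity g)
    (f₀ g₀ : ℝ → ℝ) (hf₀ : f₀ ∈ Df) (hg₀ : g₀ ∈ Dg)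
    (hmin : MinimaxFiltering.MinimalityCondition n τ f₀ g₀)
    (hmax : ∀ f ∈ Df, ∀ g ∈ Dg, MinimaxFiltering.errorFunctional n τ a f g ≤
      MinimaxFiltering.errorFunctional n τ a f₀ g₀) :
    MinimaxFiltering.IsLeastFavorable n τ a Df Dg f₀ g₀ ∧
    MinimaxFiltering.IsOptimal n τ a f₀ g₀ (MinimaxFiltering.specChar n τ a f₀ g₀) ∧
    (Convex ℝ Df → Convex ℝ Dg →
      MinimaxFiltering.specChar n τ a f₀ g₀ ∈ MinimaxFiltering.HD n τ Df Dg →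
      MinimaxFiltering.IsMinimaxRobust n τ a Df Dg
        (MinimaxFiltering.specChar n τ a f₀ g₀)) := by
  have hlf := MinimaxFiltering.isLeastFavorable_of_errorFunctional_le hτ ha hDf hDg hf₀ hg₀ hmax
  have hopt := MinimaxFiltering.isOptimal_specChar (n := n) hτ (hDf f₀ hf₀) (hDg g₀ hg₀) ha
  refine ⟨hlf, hopt, fun hcf hcg hh => ?_⟩
  exact MinimaxFiltering.isMinimaxRobust_of_msError_le hf₀ hg₀ hh hopt fun f hf g hg =>
    MinimaxFiltering.msError_specChar_le hτ ha hDf hDg hcf hcg hlf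
      (hmin.ae_obsDensity_ne_zero (hDf f₀ hf₀) (hDg g₀ hg₀)) hf hg
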